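/- **Setting.** Fix $p\ge 1$. Along a sequence of designs (limits below are along this sequence) there are $m$ clusters of sizes $n_1,\dots,n_m$; put $N=\sum_i n_i$, $n=N/m$, $n_L=\min_i n_i$. The covariates $\boldsymbol x_{ij}\in\mathbb R^p$ ($1\le i\le m$, $1\le j\le n_i$) are non-random and enter both as fixed and as random effect covariates; $\boldsymbol X_i=[\boldsymbol x_{i1},\dots,\boldsymbol x_{in_i}]^\top$. The clusters are independent. The random effects $\dot{\boldsymbol b}_i$ are i.i.d. $N(\boldsymbol 0,\dot{\boldsymbol G})$ in $\mathbb R^p$, and given $\dot{\boldsymbol b}_i$ the responses $y_{i1},\dots,y_{in_i}$ are independent, $y_{ij}$ having density $f(y\mid\dot{\boldsymbol\beta},\dot{\boldsymbol b}_i,\dot\phi)=\exp[\dot\phi^{-1}\{y\dot\eta_{ij}-a(\dot\eta_{ij})\}+c(y,\dot\phi)]$ with respect to a fixed measure, where $\dot\eta_{ij}=\boldsymbol x_{ij}^\top\dot{\boldsymbol\beta}+\boldsymbol x_{ij}^\top\dot{\boldsymbol b}_i$, $\dot\phi>0$, and the natural parameter space is $\mathbb R$. Let $\hat{\boldsymbol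 G}$ and $\hat\phi$ be (possibly random) working quantities. The PQL estimator $\hat{\boldsymbol\theta}=(\hat{\boldsymbol\beta},\hat{\boldsymbol b}_1,\dots,\hat{\boldsymbol b}_m)$ is a random vector maximising over $\mathbb R^{(m+1)p}$ $$Q(\boldsymbol\beta,\boldsymbol b)=\sum_{i=1}^m\sum_{j=1}^{n_i}\ln f(y_{ij}\mid\boldsymbol\beta,\boldsymbol b_i,\hat\phi)-\tfrac12\sum_{i=1}^m\boldsymbol b_i^\top\hat{\boldsymbol G}^{-1}\boldsymbol b_i .$$ Write $\dot{\boldsymbol\mu}_i=(a'(\dot\eta_{ij}))_j$, $\dot{\boldsymbol W}_i=\hat\phi^{-1}\mathrm{diag}\{a''(\dot\eta_{ij})\}_j$ and $\dot{\boldsymbol H}_i=(n_i^{-1}\hat\phi\dot\phi^{-1}\boldsymbol X_i^\top\dot{\boldsymbol W}_i\boldsymbol X_i)^{-1}$. **Conditions.** * (C1) $a$ is three times continuously differentiable and, for some $c_0>0$, $c_0\le a''\le c_0^{-1}$ and $|a'''|\le c_0^{-1}$ on $\mathbb R$. * (C2) $\|\boldsymbol x_{ij}\|_\infty<C_1$ for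 all $i,j$ and a constant $C_1$. From some stage on, all the matrices $\boldsymbol X_i^\top\dot{\boldsymbol W}_i\boldsymbol X_i$ are almost surely invertible. The limits in probability $\dot{\boldsymbol K}_i=\lim\dot{\boldsymbol H}_i$ (each $i$) and $\dot{\boldsymbol K}=\lim m^{-1}\sum_{i=1}^m n\,n_i^{-1}\dot{\boldsymbol H}_i$, which may be random, exist and are almost surely positive definite with all eigenvalues in $[c_1,c_1^{-1}]$, for a constant $c_1>0$. * (C3) $(\dot{\boldsymbol\beta},\dot{\boldsymbol b}_1,\dots,\dot{\boldsymbol b}_m)$ is almost surely an interior point of some compact subset of $\mathbb R^{(m+1)p}$, which may depend on the realisation. * (C4) $\hat{\boldsymbol G}$ is positive definite with $\hat{\boldsymbol G}^{-1}=O_p(1)$; $\hat\phi>0$ and $\hat\phi=O_p(1)$. * (C5) For all $i$, every component of $n_i^{1/2}(\boldsymbol X_i^\top\dot{\boldsymbol W}_i\boldsymbol X_i+\hat{\boldsymbol G}^{-1})^{-1}\{\hat\phi^{-1}\boldsymbol X_i^\top(\boldsymbol y_i-\dot{\boldsymbol\mu}_i)-\hat{\boldsymbol G}^{-1}\dot{\boldsymbol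 b}_i\}$ has a finite fourth moment. **Theorem.** Assume (C1)–(C5), $m\to\infty$, $n_L\to\infty$, $n_i=O(n_L)$ uniformly in $i$, and $m n_L^{-2}\to0$. Let $\boldsymbol A_r$ be $q\times mp$ matrices ($q$ fixed) with the finite selection property: for each row there is an $m_0$ such that, whenever $m>m_0$, the entries of the row belonging to the clusters $i>m_0$ vanish; and every entry converges. Then, unconditionally on the random effects, with $\hat{\boldsymbol b}=(\hat{\boldsymbol b}_1^\top,\dots,\hat{\boldsymbol b}_m^\top)^\top$ and $\dot{\boldsymbol b}=(\dot{\boldsymbol b}_1^\top,\dots,\dot{\boldsymbol b}_m^\top)^\top$, $$\boldsymbol A_r(\hat{\boldsymbol b}-\dot{\boldsymbol b})\xrightarrow{P}\boldsymbol 0_q .$$ Consequently, for each fixed $i$, $\hat{\boldsymbol b}_i$ converges in distribution to $\dot{\boldsymbol b}_i\sim N(\boldsymbol 0,\dot{\boldsymbol G})$; more generally, for every finite set $s$ of clusters, $(\hat{\boldsymbol b}_i)_{i\in s}$ converges jointly in distribution to $(\dot{\boldsymbol b}_i)_{i\in s}$. -/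

import Mathlib

open MeasureTheory ProbabilityTheory Filter Topology
open scoped Matrix ENNReal

noncomputable section

namespace PQL

/-- `p`-dimensional Euclidean space. -/
abbrev Vec (p : ℕ) : Type := EuclideanSpace ℝ (Fin p)

/-- Exponential family density with natural parameter `η` and dispersion `φ`. -/
def density (a : ℝ → ℝ) (c : ℝ → ℝ → ℝ) (φ η y : ℝ) : ℝ :=
  Real.exp (φ⁻¹ * (y * η - a η) + c y φ)

/-- The response distribution: the exponential family density with respect to `ν`
(for instance Lebesgue or counting measure). -/
def responseLaw (a : ℝ → ℝ) (c : ℝ → ℝ → ℝ) (ν : Measure ℝ) (φ η : ℝ) : Measure ℝ :=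
  ν.withDensity fun y => ENNReal.ofReal (density a c φ η y)

/-- The linear predictor `xᵀβ + xᵀb`, every covariate being both a fixed and a random effect
covariate. -/
def linPred {p : ℕ} (x β b : Vec p) : ℝ := inner ℝ x β + inner ℝ x b

/-- The PQL objective function of `(β, b)`, for `m` clusters of sizes `n i`, covariates `x i j` and
responses `y i j` (`i < m`, `j < n i`), at the dispersion `φ` and random effects covariance `G`. -/
def objective {p : ℕ} (a : ℝ → ℝ) (c : ℝ → ℝ → ℝ) (φ : ℝ) (G : Matrix (Fin p) (Fin p) ℝ)
    (m : ℕ) (n : ℕ → ℕ) (x : ℕ → ℕ → Vec p) (y : ℕ → ℕ → ℝ) (θ : Vec p × (Fin m → Vec p)) : ℝ :=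
  (∑ i : Fin m, ∑ j ∈ Finset.range (n i),
      Real.log (density a c φ (linPred (x i j) θ.1 (θ.2 i)) (y i j)))
    - 1 / 2 * ∑ i : Fin m, (θ.2 i).ofLp ⬝ᵥ (G⁻¹ *ᵥ (θ.2 i).ofLp)

/-- The data of a sequence, indexed by `k`, of independent-cluster GLMMs with growing number of
clusters and cluster sizes, together with working quantities and estimators. Clusters and
measurements are numbered from `0`. Only `n k i`, `x k i j`, `y k i j` with `i < m k` and
`j < n k i` play a role at stage `k`. -/
structure GLMMSeq (p : ℕ) (Ω : Type*) where
  /-- number of clusters -/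
  m : ℕ → ℕ
  /-- cluster sizes -/
  n : ℕ → ℕ → ℕ
  /-- covariates -/
  x : ℕ → ℕ → ℕ → Vec p
  /-- cumulant function of the exponential family -/
  a : ℝ → ℝ
  /-- normalising function of the exponential family -/
  c : ℝ → ℝ → ℝ
  /-- dominating measure of the exponential family -/
  ν : Measure ℝ
  /-- true fixed effects -/
  β : Vec p
  /-- true dispersion -/
  φ : ℝ
  /-- true random effects covariance matrix -/
  G : Matrix (Fin p) (Fin p) ℝ
  /-- true realised random effects -/
  b : ℕ → Ω → Vec p
  /-- responses -/
  y : ℕ → ℕ → ℕ → Ω → ℝ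
  /-- working covariance matrix -/
  Ghat : ℕ → Ω → Matrix (Fin p) (Fin p) ℝ
  /-- working dispersion -/
  φhat : ℕ → Ω → ℝ
  /-- estimator of the fixed effects -/
  βhat : ℕ → Ω → Vec p
  /-- predictors of the random effects -/
  bhat : (k : ℕ) → Ω → Fin (m k) → Vec p

namespace GLMMSeq

variable {p : ℕ} {Ω : Type*}

/-- Minimal cluster size `n_L`. -/
def nL (S : GLMMSeq p Ω) (k : ℕ) : ℕ := ⨅ i : Fin (S.m k), S.n k i

/-- Mean cluster size `n = N / m`. -/
def nBar (S : GLMMSeq p Ω) (k : ℕ) : ℝ := (∑ i : Fin (S.m k), (S.n k i : ℝ)) / S.m k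

/-- True linear predictor of measurement `j` of cluster `i`. -/
def eta (S : GLMMSeq p Ω) (k i j : ℕ) (ω : Ω) : ℝ := linPred (S.x k i j) S.β (S.b i ω)

/-- The design matrix `X_i`. -/
def X (S : GLMMSeq p Ω) (k i : ℕ) : Matrix (Fin (S.n k i)) (Fin p) ℝ :=
  Matrix.of fun j l => S.x k i j l

/-- The weight matrix `W_i` at the true parameters. -/
def W (S : GLMMSeq p Ω) (k i : ℕ) (ω : Ω) : Matrix (Fin (S.n k i)) (Fin (S.n k i)) ℝ :=
  (S.φhat k ω)⁻¹ • Matrix.diagonal fun j : Fin (S.n k i) => iteratedDeriv 2 S.a (S.eta k i j ω)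

/-- The residual vector `y_i - μ_i` at the true parameters. -/
def resid (S : GLMMSeq p Ω) (k i : ℕ) (ω : Ω) : Fin (S.n k i) → ℝ :=
  fun j => S.y k i j ω - deriv S.a (S.eta k i j ω)

/-- The information matrix `X_iᵀ W_i X_i` at the true parameters. -/
def info (S : GLMMSeq p Ω) (k i : ℕ) (ω : Ω) : Matrix (Fin p) (Fin p) ℝ :=
  (S.X k i)ᵀ * S.W k i ω * S.X k i

/-- `H_i = (n_i⁻¹ φhat φ⁻¹ X_iᵀ W_i X_i)⁻¹`. -/
def H (S : GLMMSeq p Ω) (k i : ℕ) (ω : Ω) : Matrix (Fin p) (Fin p) ℝ :=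
  (((S.n k i : ℝ)⁻¹ * S.φhat k ω * S.φ⁻¹) • S.info k i ω)⁻¹

/-- The normalised one-step prediction error of cluster `i`:
`n_i^{1/2} (X_iᵀ W_i X_i + Ghat⁻¹)⁻¹ {φhat⁻¹ X_iᵀ (y_i - μ_i) - Ghat⁻¹ b_i}`. -/
def oneStep (S : GLMMSeq p Ω) (k i : ℕ) (ω : Ω) : Fin p → ℝ :=
  Real.sqrt (S.n k i) • ((S.info k i ω + (S.Ghat k ω)⁻¹)⁻¹ *ᵥ
    ((S.φhat k ω)⁻¹ • ((S.X k i)ᵀ *ᵥ S.resid k i ω) - (S.Ghat k ω)⁻¹ *ᵥ (S.b i ω).ofLp))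

/-- The vector of true random effects of the clusters present at stage `k`. -/
def bTrue (S : GLMMSeq p Ω) (k : ℕ) (ω : Ω) : Fin (S.m k) → Vec p := fun i => S.b i ω

/-- The predictor of the random effect of cluster `i`, set to `0` at the (finitely many, when
`m → ∞`) stages `k` at which cluster `i` is not yet present. -/
def bhatAt (S : GLMMSeq p Ω) (i k : ℕ) (ω : Ω) : Vec p :=
  if h : i < S.m k then S.bhat k ω ⟨i, h⟩ else 0

end GLMMSeq

variable {p : ℕ} {Ω : Type*} [MeasurableSpace Ω]

/-- `O_p(1)`. -/
def BoundedInProbability (μ : Measure Ω) (Z : ℕ → Ω → ℝ) : Prop :=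
  ∀ ε : ℝ≥0∞, 0 < ε → ∃ M : ℝ, ∀ᶠ k in atTop, μ {ω | M < |Z k ω|} ≤ ε

/-- The true model. The clusters are independent, the random effects are `N(0, G)`, and given the
random effect of a cluster its responses are independent with the exponential family law whose
natural parameter is the linear predictor (canonical link). -/
structure IsGLMM (S : GLMMSeq p Ω) (μ : Measure Ω) : Prop where
  measurable_c : Measurable fun y => S.c y S.φ
  isDensity : ∀ η : ℝ, ∫⁻ y, ENNReal.ofReal (density S.a S.c S.φ η y) ∂S.ν = 1
  dispersion_pos : 0 < S.φ
  cov_posSemidef : S.G.PosSemidef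
  measurable_b : ∀ i, Measurable (S.b i)
  measurable_y : ∀ k i j, Measurable (S.y k i j)
  law_b : ∀ i, μ.map (S.b i) = multivariateGaussian 0 S.G
  indep_clusters : ∀ k, iIndepFun
    (fun (i : Fin (S.m k)) (ω : Ω) =>
      ((S.b i ω, fun j => S.y k i j ω) : Vec p × (Fin (S.n k i) → ℝ))) μ
  cond_law : ∀ k, ∀ i < S.m k, ∀ B : Set (Vec p), MeasurableSet B →
    ∀ A : Fin (S.n k i) → Set ℝ, (∀ j, MeasurableSet (A j)) →
      μ {ω | S.b i ω ∈ B ∧ ∀ j : Fin (S.n k i), S.y k i j ω ∈ A j} =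
        ∫⁻ u in B, ∏ j : Fin (S.n k i),
          responseLaw S.a S.c S.ν S.φ (linPred (S.x k i j) S.β u) (A j)
          ∂(multivariateGaussian 0 S.G)

/-- `(βhat, bhat)` is the PQL estimator: a random vector that maximises the PQL objective function
at the working dispersion and covariance matrix. -/
structure IsPQLEstimator (S : GLMMSeq p Ω) (μ : Measure Ω) : Prop where
  measurable_βhat : ∀ k, Measurable (S.βhat k)
  measurable_bhat : ∀ k, Measurable (S.bhat k)
  isMax : ∀ k, ∀ᵐ ω ∂μ, ∀ θ : Vec p × (Fin (S.m k) → Vec p),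
    objective S.a S.c (S.φhat k ω) (S.Ghat k ω) (S.m k) (S.n k) (S.x k)
        (fun i j => S.y k i j ω) θ ≤
      objective S.a S.c (S.φhat k ω) (S.Ghat k ω) (S.m k) (S.n k) (S.x k)
        (fun i j => S.y k i j ω) (S.βhat k ω, S.bhat k ω)

/-- Growth of the design: `m, n_L → ∞` and `n_i = O(n_L)` uniformly in `i`. -/
structure Growth (S : GLMMSeq p Ω) : Prop where
  m_tendsto : Tendsto S.m atTop atTop
  nL_tendsto : Tendsto S.nL atTop atTop
  balanced : ∃ C : ℝ, ∀ᶠ k in atTop, ∀ i < S.m k, (S.n k i : ℝ) ≤ C * S.nL k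

/-- (C1) -/
def CondC1 (S : GLMMSeq p Ω) : Prop :=
  ContDiff ℝ 3 S.a ∧ ∃ c₀ : ℝ, 0 < c₀ ∧ ∀ η : ℝ,
    c₀ ≤ iteratedDeriv 2 S.a η ∧ iteratedDeriv 2 S.a η ≤ c₀⁻¹ ∧ |iteratedDeriv 3 S.a η| ≤ c₀⁻¹

/-- (C2). The matrices `H_i` depend on the random effects, so that their limits may be random and
are taken in probability. -/
structure CondC2 (S : GLMMSeq p Ω) (μ : Measure Ω) : Prop where
  bounded : ∃ C₁ : ℝ, ∀ k, ∀ i < S.m k, ∀ j < S.n k i, ∀ l, |S.x k i j l| < C₁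
  isUnit_info : ∀ᶠ k in atTop, ∀ i < S.m k, ∀ᵐ ω ∂μ, IsUnit (S.info k i ω)
  limits : ∃ (Kc : ℕ → Ω → Matrix (Fin p) (Fin p) ℝ) (K : Ω → Matrix (Fin p) (Fin p) ℝ) (c₁ : ℝ),
    0 < c₁ ∧
    (∀ i l l', TendstoInMeasure μ (fun k ω => S.H k i ω l l') atTop (fun ω => Kc i ω l l')) ∧
    (∀ l l', TendstoInMeasure μ
      (fun k ω => (S.m k : ℝ)⁻¹ *
        ∑ i : Fin (S.m k), S.nBar k * (S.n k i : ℝ)⁻¹ * S.H k i ω l l') atTop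
      (fun ω => K ω l l')) ∧
    (∀ i, ∀ᵐ ω ∂μ, (Kc i ω).PosDef ∧ spectrum ℝ (Kc i ω) ⊆ Set.Icc c₁ c₁⁻¹) ∧
    (∀ᵐ ω ∂μ, (K ω).PosDef ∧ spectrum ℝ (K ω) ⊆ Set.Icc c₁ c₁⁻¹)

/-- (C3) -/
def CondC3 (S : GLMMSeq p Ω) (μ : Measure Ω) : Prop :=
  ∀ k, ∀ᵐ ω ∂μ, ∃ Θ : Set (Vec p × (Fin (S.m k) → Vec p)),
    IsCompact Θ ∧ (S.β, S.bTrue k ω) ∈ interior Θ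

/-- (C4) -/
structure CondC4 (S : GLMMSeq p Ω) (μ : Measure Ω) : Prop where
  measurable_Ghat : ∀ k l l', Measurable fun ω => S.Ghat k ω l l'
  measurable_φhat : ∀ k, Measurable (S.φhat k)
  posDef : ∀ k, ∀ᵐ ω ∂μ, (S.Ghat k ω).PosDef
  inv_bounded : ∀ l l', BoundedInProbability μ fun k ω => (S.Ghat k ω)⁻¹ l l'
  φhat_pos : ∀ k, ∀ᵐ ω ∂μ, 0 < S.φhat k ω
  φhat_bounded : BoundedInProbability μ S.φhat

/-- (C5) -/
def CondC5 (S : GLMMSeq p Ω) (μ : Measure Ω) : Prop :=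
  ∀ k, ∀ i < S.m k, ∀ l, Integrable (fun ω => S.oneStep k i ω l ^ 4) μ

/-- The finite selection property of the matrices `A_r`, of size `q × (m k) p`: each row involves
only finitely many clusters, the same ones for all `k`, and each entry has a limit. -/
structure FiniteSelection {q : ℕ} (m : ℕ → ℕ)
    (A : (k : ℕ) → Matrix (Fin q) (Fin (m k) × Fin p) ℝ) : Prop where
  finite : ∀ r, ∃ m₀ : ℕ, ∀ k, m₀ < m k → ∀ i : Fin (m k), m₀ ≤ (i : ℕ) → ∀ l, A k r (i, l) = 0
  limit : ∀ r (i : ℕ) l, ∃ L : ℝ,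
    Tendsto (fun k => if h : i < m k then A k r (⟨i, h⟩, l) else 0) atTop (𝓝 L)

end PQL

end

/-! Since every covariate carries both a fixed and a random effect, the likelihood sees only the
totals `β + b_i`. Moving a common vector from the random effects to the fixed effect changes only
the penalty, so at a maximiser the predicted random effects sum to zero (`sum_eq_zero_of_isMax`).
Hence `βhat - β` equals the mean of the true `b_i` plus the mean of the errors δ_i of the totals,
and the prediction error of cluster i is δ_i minus `βhat - β`.

The total of a cluster is estimated by penalised maximum likelihood from its own responses. Testing
its score equation in the direction δ_i and using `a'' ≥ c₀` bounds `c₀ |X_i δ_i|²` by `‖δ_i‖` times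
the score norm plus penalty terms in `b_i` and `βhat - β` (`gram_totalError_le`). With L_i the
reciprocal of the smallest eigenvalue of `n_i⁻¹ X_iᵀ X_i`, this bounds `‖δ_i‖` by L_i times an
average score plus a penalty of order `1 / n_L` (`norm_totalError_le`). Averaged over clusters, the
term in `‖βhat - β‖` has a small coefficient and is absorbed on the left (`norm_beta_error_le`). No
Taylor expansion of the estimator is needed.

The L_i depend on the design alone, so limits in probability of the `H_i` yield deterministic bounds
on L_i and on their mean (`eventually_le_of_tendstoInMeasure`), and the L_i leave expectations as
constants. What remains is first moments: a score of cluster i is of order `√n_i` and the mean of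
the `b_i` of order `1/√m`. The working quantities enter only through `penalty`, which is bounded in
probability, so one works where it is at most `M` and applies Markov's inequality
(`tendstoInMeasure_zero_of_dominated`). -/

noncomputable section

namespace PQL

/-! ### Moments of the exponential family -/

section ExponentialFamily

variable {a : ℝ → ℝ} {c : ℝ → ℝ → ℝ} {ν : Measure ℝ} {φ : ℝ}

lemma density_pos (η y : ℝ) : 0 < density a c φ η y := Real.exp_pos _

lemma measurable_density (hc : Measurable fun y => c y φ) (η : ℝ) :
    Measurable (density a c φ η) := by
  unfold density; fun_prop

lemma measurable_density_uncurry (ha : Measurable a) (hc : Measurable fun y => c y φ) :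
    Measurable fun z : ℝ × ℝ => density a c φ z.1 z.2 := by
  unfold density
  have h1 : Measurable fun z : ℝ × ℝ => c z.2 φ := hc.comp measurable_snd
  have h2 : Measurable fun z : ℝ × ℝ => a z.1 := ha.comp measurable_fst
  fun_prop

/-- The density is positive and finite, so `ν` is recovered from a probability measure by the
reciprocal density. σ-finiteness is what makes the response law measurable in `η`. -/
lemma sigmaFinite_of_isDensity (hc : Measurable fun y => c y φ)
    (h : ∀ η : ℝ, ∫⁻ y, ENNReal.ofReal (density a c φ η y) ∂ν = 1) : SigmaFinite ν := by
  have hm : Measurable fun y => ENNReal.ofReal (density a c φ 0 y) :=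
    (measurable_density hc 0).ennreal_ofReal
  have hfin : IsFiniteMeasure (ν.withDensity fun y => ENNReal.ofReal (density a c φ 0 y)) :=
    isFiniteMeasure_withDensity (by rw [h]; simp)
  have hinv : (ν.withDensity fun y => ENNReal.ofReal (density a c φ 0 y)).withDensity
      (fun y => (ENNReal.ofReal (density a c φ 0 y))⁻¹) = ν :=
    withDensity_inv_same hm (by simp [density_pos]) (by simp)
  rw [← hinv]
  exact SigmaFinite.withDensity_of_ne_top (by simp [density_pos])

lemma isProbabilityMeasure_responseLaw
    (h : ∀ η : ℝ, ∫⁻ y, ENNReal.ofReal (density a c φ η y) ∂ν = 1) (η : ℝ) :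
    IsProbabilityMeasure (responseLaw a c ν φ η) :=
  ⟨by rw [responseLaw, withDensity_apply _ MeasurableSet.univ, Measure.restrict_univ, h]⟩

lemma measurable_responseLaw (ha : Measurable a) (hc : Measurable fun y => c y φ)
    (h : ∀ η : ℝ, ∫⁻ y, ENNReal.ofReal (density a c φ η y) ∂ν = 1) {s : Set ℝ}
    (hs : MeasurableSet s) : Measurable fun η => responseLaw a c ν φ η s := by
  have := sigmaFinite_of_isDensity hc h
  simp only [responseLaw, withDensity_apply _ hs]
  exact (measurable_density_uncurry ha hc).ennreal_ofReal.lintegral_prod_right'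

/-- Exponential tilting by `t` stays in the family: it moves `η` to `η + φ t`, whose density again
has mass one. All moments exist because `η` ranges over the whole line. -/
lemma lintegral_exp_mul_responseLaw (hφ : 0 < φ) (hc : Measurable fun y => c y φ)
    (h : ∀ η : ℝ, ∫⁻ y, ENNReal.ofReal (density a c φ η y) ∂ν = 1) (η t : ℝ) :
    ∫⁻ y, ENNReal.ofReal (Real.exp (t * y)) ∂responseLaw a c ν φ η =
      ENNReal.ofReal (Real.exp (φ⁻¹ * (a (η + φ * t) - a η))) := by
  rw [responseLaw, lintegral_withDensity_eq_lintegral_mul _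
    (measurable_density hc η).ennreal_ofReal (by fun_prop)]
  have : ∀ y, ENNReal.ofReal (density a c φ η y) * ENNReal.ofReal (Real.exp (t * y)) =
      ENNReal.ofReal (Real.exp (φ⁻¹ * (a (η + φ * t) - a η))) *
        ENNReal.ofReal (density a c φ (η + φ * t) y) := by
    intro y
    rw [← ENNReal.ofReal_mul (density_pos _ _).le, ← ENNReal.ofReal_mul (Real.exp_pos _).le]
    simp only [density, ← Real.exp_add]
    congr 2
    field_simp
    ring
  simp only [Pi.mul_apply, this]
  rw [lintegral_const_mul _ (measurable_density hc _).ennreal_ofReal, h, mul_one]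

lemma integrable_exp_mul_responseLaw (hφ : 0 < φ) (hc : Measurable fun y => c y φ)
    (h : ∀ η : ℝ, ∫⁻ y, ENNReal.ofReal (density a c φ η y) ∂ν = 1) (η t : ℝ) :
    Integrable (fun y => Real.exp (t * y)) (responseLaw a c ν φ η) := by
  refine ⟨by fun_prop, ?_⟩
  rw [hasFiniteIntegral_iff_ofReal (ae_of_all _ fun _ => (Real.exp_pos _).le),
    lintegral_exp_mul_responseLaw hφ hc h]
  exact ENNReal.ofReal_lt_top

lemma cgf_responseLaw (hφ : 0 < φ) (hc : Measurable fun y => c y φ)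
    (h : ∀ η : ℝ, ∫⁻ y, ENNReal.ofReal (density a c φ η y) ∂ν = 1) (η : ℝ) :
    cgf id (responseLaw a c ν φ η) = fun t => φ⁻¹ * (a (η + φ * t) - a η) := by
  ext t
  rw [cgf, mgf, integral_eq_lintegral_of_nonneg_ae (ae_of_all _ fun _ => (Real.exp_pos _).le)
    (by fun_prop)]
  simp only [id]
  rw [lintegral_exp_mul_responseLaw hφ hc h, ENNReal.toReal_ofReal (Real.exp_pos _).le,
    Real.log_exp]

lemma zero_mem_interior_integrableExpSet_responseLaw (hφ : 0 < φ) (hc : Measurable fun y => c y φ)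
    (h : ∀ η : ℝ, ∫⁻ y, ENNReal.ofReal (density a c φ η y) ∂ν = 1) (η : ℝ) :
    0 ∈ interior (integrableExpSet id (responseLaw a c ν φ η)) := by
  have : integrableExpSet id (responseLaw a c ν φ η) = Set.univ :=
    Set.eq_univ_of_forall fun t => integrable_exp_mul_responseLaw hφ hc h η t
  simp [this]

lemma memLp_id_responseLaw (hφ : 0 < φ) (hc : Measurable fun y => c y φ)
    (h : ∀ η : ℝ, ∫⁻ y, ENNReal.ofReal (density a c φ η y) ∂ν = 1) (η : ℝ) :
    MemLp id 2 (responseLaw a c ν φ η) := by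
  exact_mod_cast memLp_of_mem_interior_integrableExpSet
    (zero_mem_interior_integrableExpSet_responseLaw hφ hc h η) 2

lemma hasDerivAt_comp_affine {g : ℝ → ℝ} (hg : Differentiable ℝ g) (η r t : ℝ) :
    HasDerivAt (fun t => g (η + r * t)) (deriv g (η + r * t) * r) t := by
  have h : HasDerivAt (fun t : ℝ => η + r * t) r t := by
    simpa using ((hasDerivAt_id t).const_mul r).const_add η
  exact (hg (η + r * t)).hasDerivAt.comp t h

lemma deriv_cgf_responseLaw (ha : Differentiable ℝ a) (hφ : 0 < φ)
    (hc : Measurable fun y => c y φ)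
    (h : ∀ η : ℝ, ∫⁻ y, ENNReal.ofReal (density a c φ η y) ∂ν = 1) (η : ℝ) :
    deriv (cgf id (responseLaw a c ν φ η)) = fun t => deriv a (η + φ * t) := by
  ext t
  rw [cgf_responseLaw hφ hc h,
    (((hasDerivAt_comp_affine ha η φ t).sub_const (a η)).const_mul φ⁻¹).deriv]
  field_simp

lemma integral_id_responseLaw (ha : Differentiable ℝ a) (hφ : 0 < φ)
    (hc : Measurable fun y => c y φ)
    (h : ∀ η : ℝ, ∫⁻ y, ENNReal.ofReal (density a c φ η y) ∂ν = 1) (η : ℝ) :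
    ∫ y, y ∂responseLaw a c ν φ η = deriv a η := by
  have := isProbabilityMeasure_responseLaw h η
  have h1 := deriv_cgf_zero (zero_mem_interior_integrableExpSet_responseLaw hφ hc h η)
  rw [deriv_cgf_responseLaw ha hφ hc h] at h1
  simpa using h1.symm

/-- The variance is the second derivative at 0 of the cumulant generating function `φ⁻¹ (a (η + φ t)
- a η)`. -/
lemma variance_id_responseLaw (ha : ContDiff ℝ 2 a) (hφ : 0 < φ)
    (hc : Measurable fun y => c y φ)
    (h : ∀ η : ℝ, ∫⁻ y, ENNReal.ofReal (density a c φ η y) ∂ν = 1) (η : ℝ) :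
    Var[id; responseLaw a c ν φ η] = φ * iteratedDeriv 2 a η := by
  have := isProbabilityMeasure_responseLaw h η
  have h1 := iteratedDeriv_two_cgf_eq_integral
    (zero_mem_interior_integrableExpSet_responseLaw hφ hc h η)
  have hd : Differentiable ℝ a := ha.differentiable (by norm_num)
  have hdd : Differentiable ℝ (deriv a) :=
    (ContDiff.iterate_deriv' 1 1 (by simpa using ha)).differentiable (by norm_num)
  rw [iteratedDeriv_succ, iteratedDeriv_one, deriv_cgf_responseLaw hd hφ hc h,
    (hasDerivAt_comp_affine hdd η φ 0).deriv] at h1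
  rw [variance_eq_integral aemeasurable_id, iteratedDeriv_succ, iteratedDeriv_one]
  simp only [mul_zero, add_zero, id, zero_mul, Real.exp_zero, mul_one, mgf_zero, div_one] at h1 ⊢
  rw [integral_id_responseLaw hd hφ hc h, ← h1, mul_comm]

/-- A weighted sum of independent centred responses has the expected second moment bound. -/
lemma lintegral_sq_sum_responseLaw_le (ha : ContDiff ℝ 2 a) (hφ : 0 < φ)
    (hc : Measurable fun y => c y φ)
    (h : ∀ η : ℝ, ∫⁻ y, ENNReal.ofReal (density a c φ η y) ∂ν = 1)
    {B : ℝ} (hB : ∀ η, iteratedDeriv 2 a η ≤ B)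
    {n : ℕ} (η w : Fin n → ℝ) {C : ℝ} (hw : ∀ j, |w j| ≤ C) :
    ∫⁻ z, ENNReal.ofReal ((∑ j, w j * (z j - deriv a (η j))) ^ 2)
        ∂Measure.pi (fun j => responseLaw a c ν φ (η j)) ≤
      ENNReal.ofReal (n * (C ^ 2 * (φ * B))) := by
  have hprob := fun j => isProbabilityMeasure_responseLaw h (η j)
  have hd : Differentiable ℝ a := ha.differentiable (by norm_num)
  have hL : ∀ j, MemLp (fun y => w j * (y - deriv a (η j))) 2 (responseLaw a c ν φ (η j)) :=
    fun j => ((memLp_id_responseLaw hφ hc h (η j)).sub (memLp_const _)).const_mul _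
  have hLz : ∀ j, MemLp (fun z : Fin n → ℝ => w j * (z j - deriv a (η j))) 2
      (Measure.pi fun j => responseLaw a c ν φ (η j)) := fun j =>
    (hL j).comp_measurePreserving (measurePreserving_eval _ j)
  have hmean : ∀ j, ∫ z : Fin n → ℝ, w j * (z j - deriv a (η j))
      ∂(Measure.pi fun j => responseLaw a c ν φ (η j)) = 0 := by
    intro j
    have hmp := measurePreserving_eval (fun j => responseLaw a c ν φ (η j)) j
    have hi : Integrable (fun y : ℝ => y) (responseLaw a c ν φ (η j)) :=
      (memLp_id_responseLaw hφ hc h (η j)).integrable (by norm_num)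
    have hmap := integral_map (μ := Measure.pi fun j => responseLaw a c ν φ (η j))
      (f := fun y : ℝ => w j * (y - deriv a (η j)))
      hmp.measurable.aemeasurable (by fun_prop)
    rw [hmp.map_eq, integral_const_mul, integral_sub hi (integrable_const _),
      integral_id_responseLaw hd hφ hc h] at hmap
    simpa using hmap.symm
  have hsum : MemLp (fun z : Fin n → ℝ => ∑ j, w j * (z j - deriv a (η j))) 2
      (Measure.pi fun j => responseLaw a c ν φ (η j)) := memLp_finsetSum _ fun j _ => hLz j
  have hmeanS : ∫ z : Fin n → ℝ, ∑ j, w j * (z j - deriv a (η j))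
      ∂(Measure.pi fun j => responseLaw a c ν φ (η j)) = 0 := by
    rw [integral_finsetSum _ fun j _ => (hLz j).integrable (by norm_num)]
    simp [hmean]
  rw [← ofReal_integral_eq_lintegral_ofReal hsum.integrable_sq (ae_of_all _ fun _ => sq_nonneg _)]
  refine ENNReal.ofReal_le_ofReal ?_
  have hv := variance_of_integral_eq_zero hsum.aemeasurable hmeanS
  have hv2 := variance_sum_pi (X := fun j y => w j * (y - deriv a (η j))) hL
  have e : (∑ j, fun z : Fin n → ℝ => w j * (z j - deriv a (η j))) =
    fun z : Fin n → ℝ => ∑ j, w j * (z j - deriv a (η j)) := by ext; simp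
  rw [e] at hv2
  rw [← hv, hv2]
  calc _ ≤ ∑ j : Fin n, C ^ 2 * (φ * B) := by
        refine Finset.sum_le_sum fun j _ => ?_
        rw [variance_const_mul, variance_sub_const (by fun_prop)]
        rw [show (fun y : ℝ => y) = id from rfl]
        have hV := variance_nonneg id (responseLaw a c ν φ (η j))
        rw [variance_id_responseLaw ha hφ hc h] at hV ⊢
        exact mul_le_mul (sq_le_sq' (neg_le_of_abs_le (hw j)) (le_of_abs_le (hw j)))
          (mul_le_mul_of_nonneg_left (hB _) hφ.le) hV (sq_nonneg C)
    _ = _ := by simp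

end ExponentialFamily

/-! ### First moments of scores and random effects -/

section Model

variable {p : ℕ} {Ω : Type*} [MeasurableSpace Ω] {μ : Measure Ω} {S : GLMMSeq p Ω}

/-- The conditional law of the responses of cluster `i` given its random effect. -/
def clusterLaw (S : GLMMSeq p Ω) (k i : ℕ) (u : Vec p) : Measure (Fin (S.n k i) → ℝ) :=
  Measure.pi fun j => responseLaw S.a S.c S.ν S.φ (linPred (S.x k i j) S.β u)

lemma isProbabilityMeasure_clusterLaw (h : IsGLMM S μ) (k i : ℕ) (u : Vec p) :
    IsProbabilityMeasure (clusterLaw S k i u) := by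
  have := fun η => isProbabilityMeasure_responseLaw h.isDensity η
  unfold clusterLaw
  infer_instance

lemma measurable_clusterLaw (h : IsGLMM S μ) (ha : Measurable S.a) (k i : ℕ) :
    Measurable (clusterLaw S k i) := by
  have := isProbabilityMeasure_clusterLaw h k i
  have h2 := fun η => isProbabilityMeasure_responseLaw h.isDensity η
  refine Measurable.measure_of_isPiSystem_of_isProbabilityMeasure generateFrom_pi.symm isPiSystem_pi
    ?_
  rintro _ ⟨A, hA, rfl⟩
  simp only [clusterLaw, Measure.pi_pi]
  refine Finset.measurable_prod _ fun j _ => ?_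
  have hl : Measurable fun u => linPred (S.x k i j) S.β u := by unfold linPred; fun_prop
  exact (measurable_responseLaw ha h.measurable_c h.isDensity (hA j (Set.mem_univ j))).comp hl

/-- The model prescribes the joint law of effect and responses on measurable boxes only; these form
a generating π-system, so the law is a Gaussian composed with the product kernel. Expectations may
then be taken conditionally on the random effect. -/
lemma lintegral_cluster [IsProbabilityMeasure μ] (h : IsGLMM S μ) (ha : Measurable S.a) {k i : ℕ}
    (hi : i < S.m k) {g : Vec p × (Fin (S.n k i) → ℝ) → ℝ≥0∞} (hg : Measurable g) :
    ∫⁻ ω, g (S.b i ω, fun j => S.y k i j ω) ∂μ =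
      ∫⁻ u, ∫⁻ z, g (u, z) ∂clusterLaw S k i u ∂multivariateGaussian 0 S.G := by
  have hprob := isProbabilityMeasure_clusterLaw h k i
  have h2 := fun η => isProbabilityMeasure_responseLaw h.isDensity η
  let κ : Kernel (Vec p) (Fin (S.n k i) → ℝ) := ⟨clusterLaw S k i, measurable_clusterLaw h ha k i⟩
  have hκ : IsMarkovKernel κ := ⟨hprob⟩
  have hm : Measurable fun ω => (S.b i ω, fun j : Fin (S.n k i) => S.y k i j ω) :=
    (h.measurable_b i).prodMk (measurable_pi_lambda _ fun j => h.measurable_y k i j)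
  have hlaw : μ.map (fun ω => (S.b i ω, fun j : Fin (S.n k i) => S.y k i j ω)) =
      multivariateGaussian 0 S.G ⊗ₘ κ := by
    have : IsProbabilityMeasure
        (μ.map (fun ω => (S.b i ω, fun j : Fin (S.n k i) => S.y k i j ω))) :=
      Measure.isProbabilityMeasure_map hm.aemeasurable
    refine ext_of_generate_finite
      (Set.image2 (· ×ˢ ·) {s : Set (Vec p) | MeasurableSet s}
        (Set.pi Set.univ '' Set.pi Set.univ fun _ : Fin (S.n k i) => {s : Set ℝ | MeasurableSet s}))
      ?_ (MeasurableSpace.isPiSystem_measurableSet.prod isPiSystem_pi) ?_ (by simp)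
    · exact (generateFrom_eq_prod MeasurableSpace.generateFrom_measurableSet generateFrom_pi
        isCountablySpanning_measurableSet
        (IsCountablySpanning.pi fun _ => isCountablySpanning_measurableSet)).symm
    · rintro _ ⟨B, hB, _, ⟨A, hA, rfl⟩, rfl⟩
      change MeasurableSet B at hB
      have hA' : ∀ j, MeasurableSet (A j) := fun j => hA j (Set.mem_univ j)
      rw [Measure.map_apply hm (hB.prod (MeasurableSet.univ_pi hA')),
        Measure.compProd_apply_prod hB (MeasurableSet.univ_pi hA')]
      have := h.cond_law k i hi B hB A hA'
      rw [show (fun ω => (S.b i ω, fun j : Fin (S.n k i) => S.y k i j ω)) ⁻¹'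
          (B ×ˢ Set.univ.pi A) = {ω | S.b i ω ∈ B ∧ ∀ j : Fin (S.n k i), S.y k i j ω ∈ A j} by
        ext; simp, this]
      refine lintegral_congr fun u => ?_
      change _ = clusterLaw S k i u _
      rw [clusterLaw, Measure.pi_pi]
  rw [← lintegral_map hg hm, hlaw, Measure.lintegral_compProd hg]
  rfl

/-- The unscaled score vector of cluster `i` at the true parameters. -/
def score {Ω : Type*} (S : GLMMSeq p Ω) (k i : ℕ) (ω : Ω) : Vec p :=
  WithLp.toLp 2 ((S.X k i)ᵀ *ᵥ S.resid k i ω)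

lemma score_apply {Ω : Type*} {S : GLMMSeq p Ω} (k i : ℕ) (ω : Ω) (l : Fin p) :
    score S k i ω l =
      ∑ j : Fin (S.n k i), S.x k i j l * (S.y k i j ω - deriv S.a (S.eta k i j ω)) := by
  simp [score, Matrix.mulVec, dotProduct, GLMMSeq.X, GLMMSeq.resid]

lemma measurable_score (h : IsGLMM S μ) (ha : Continuous (deriv S.a)) (k i : ℕ) :
    Measurable (score S k i) := by
  refine (WithLp.measurable_toLp 2 _).comp (measurable_pi_lambda _ fun l => ?_)
  have := fun ω => score_apply (S := S) k i ω l
  simp only [score] at this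
  simp only [this, GLMMSeq.eta, linPred]
  have hb := h.measurable_b i
  have hy := h.measurable_y k i
  have := ha.measurable
  fun_prop

/-- Given the random effect, the score is a sum of independent centred terms, and the bound on its
second moment does not depend on that effect. -/
lemma lintegral_sq_score_le [IsProbabilityMeasure μ] (h : IsGLMM S μ) (ha : ContDiff ℝ 2 S.a)
    {B : ℝ} (hB : ∀ η, iteratedDeriv 2 S.a η ≤ B) {k i : ℕ} (hi : i < S.m k) {C : ℝ} {l : Fin p}
    (hC : ∀ j < S.n k i, |S.x k i j l| ≤ C) :
    ∫⁻ ω, ENNReal.ofReal (score S k i ω l ^ 2) ∂μ ≤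
      ENNReal.ofReal (S.n k i * (C ^ 2 * (S.φ * B))) := by
  have hd : Measurable (deriv S.a) := (ha.continuous_deriv (by norm_num)).measurable
  have hg : Measurable fun uz : Vec p × (Fin (S.n k i) → ℝ) => ENNReal.ofReal
      ((∑ j : Fin (S.n k i),
        S.x k i j l * (uz.2 j - deriv S.a (linPred (S.x k i j) S.β uz.1))) ^ 2) := by
    unfold linPred
    fun_prop
  have h1 := lintegral_cluster h ha.continuous.measurable hi hg
  simp only [score_apply, GLMMSeq.eta]
  rw [h1]
  calc _ ≤ ∫⁻ _, ENNReal.ofReal (S.n k i * (C ^ 2 * (S.φ * B))) ∂multivariateGaussian 0 S.G :=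
        lintegral_mono fun u => lintegral_sq_sum_responseLaw_le ha h.dispersion_pos
          h.measurable_c h.isDensity hB _ _ fun j => hC j j.2
    _ = _ := by simp

lemma norm_le_sum_abs (v : Vec p) : ‖v‖ ≤ ∑ l, |v l| := by
  rw [EuclideanSpace.norm_eq]
  refine Real.sqrt_le_iff.2 ⟨Finset.sum_nonneg fun _ _ => abs_nonneg _, ?_⟩
  simpa using Finset.sum_sq_le_sq_sum_of_nonneg (s := Finset.univ) (f := fun l => |v l|)
    fun _ _ => abs_nonneg _

/-- The first absolute moment of a random vector, bounded through second moments of its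
coordinates. -/
lemma integrable_norm_of_lintegral_sq_le [IsProbabilityMeasure μ] {Z : Ω → Vec p}
    (hZ : Measurable Z) {V : ℝ} (hV : 0 ≤ V)
    (h : ∀ l, ∫⁻ ω, ENNReal.ofReal (Z ω l ^ 2) ∂μ ≤ ENNReal.ofReal V) :
    Integrable (fun ω => ‖Z ω‖) μ ∧ ∫ ω, ‖Z ω‖ ∂μ ≤ p * √V := by
  have hL : ∀ l, MemLp (fun ω => Z ω l) 2 μ := by
    intro l
    rw [memLp_two_iff_integrable_sq (by fun_prop)]
    refine ⟨by fun_prop, ?_⟩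
    rw [hasFiniteIntegral_iff_ofReal (ae_of_all _ fun _ => sq_nonneg _)]
    exact (h l).trans_lt ENNReal.ofReal_lt_top
  have hI : ∀ l, Integrable (fun ω => |Z ω l|) μ := fun l =>
    ((hL l).integrable (by norm_num)).abs
  have hS : Integrable (fun ω => ∑ l, |Z ω l|) μ := integrable_finsetSum _ fun l _ => hI l
  have hN : Integrable (fun ω => ‖Z ω‖) μ :=
    hS.mono' (by fun_prop) (ae_of_all _ fun ω => by simpa using norm_le_sum_abs (Z ω))
  refine ⟨hN, (integral_mono hN hS fun ω => norm_le_sum_abs (Z ω)).trans ?_⟩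
  rw [integral_finsetSum _ fun l _ => hI l]
  calc _ ≤ ∑ _l : Fin p, √V := by
        refine Finset.sum_le_sum fun l _ => Real.le_sqrt_of_sq_le ?_
        -- Nonnegativity of the variance of `|Z_l|` is the inequality `(E|Z_l|)² ≤ E Z_l²`.
        have h1 := variance_nonneg (fun ω => |Z ω l|) μ
        rw [variance_eq_sub (by exact (hL l).abs)] at h1
        have h2 : ∫ ω, Z ω l ^ 2 ∂μ ≤ V := by
          have := h l
          rw [← ofReal_integral_eq_lintegral_ofReal (hL l).integrable_sq
            (ae_of_all _ fun _ => sq_nonneg _)] at this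
          exact (ENNReal.ofReal_le_ofReal_iff hV).1 this
        simp only [Pi.pow_apply, sq_abs] at h1
        linarith
    _ = _ := by simp

lemma integral_norm_score_le [IsProbabilityMeasure μ] (h : IsGLMM S μ) (ha : ContDiff ℝ 2 S.a)
    {B : ℝ} (hB0 : 0 ≤ B) (hB : ∀ η, iteratedDeriv 2 S.a η ≤ B) {k i : ℕ} (hi : i < S.m k) {C : ℝ}
    (hC : ∀ j < S.n k i, ∀ l, |S.x k i j l| ≤ C) :
    Integrable (fun ω => ‖score S k i ω‖) μ ∧
      ∫ ω, ‖score S k i ω‖ ∂μ ≤ p * √(S.n k i * (C ^ 2 * (S.φ * B))) := by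
  have := h.dispersion_pos
  exact integrable_norm_of_lintegral_sq_le
    (measurable_score h (ha.continuous_deriv (by norm_num)) k i) (by positivity)
    fun l => lintegral_sq_score_le h ha hB hi fun j hj => hC j hj l

lemma memLp_b (h : IsGLMM S μ) (i : ℕ) (l : Fin p) : MemLp (fun ω => S.b i ω l) 2 μ := by
  have h1 : MemLp (fun u : Vec p => u l) 2 (multivariateGaussian 0 S.G) := by
    have := IsGaussian.memLp_dual (multivariateGaussian 0 S.G) (EuclideanSpace.proj (𝕜 := ℝ) l) 2
      (by norm_num)
    simpa using this
  rw [← h.law_b i] at h1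
  exact (memLp_map_measure_iff h1.1 (h.measurable_b i).aemeasurable).1 h1

lemma integral_b (h : IsGLMM S μ) (i : ℕ) (l : Fin p) : ∫ ω, S.b i ω l ∂μ = 0 := by
  have h1 : ∫ u : Vec p, u l ∂multivariateGaussian 0 S.G = 0 := by
    have := ContinuousLinearMap.integral_comp_comm (EuclideanSpace.proj (𝕜 := ℝ) l)
      (IsGaussian.integrable_id (μ := multivariateGaussian (0 : Vec p) S.G))
    simpa using this
  rw [← h.law_b i, integral_map (h.measurable_b i).aemeasurable (by fun_prop)] at h1
  exact h1

lemma variance_b (h : IsGLMM S μ) (i : ℕ) (l : Fin p) : Var[fun ω => S.b i ω l; μ] = S.G l l := by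
  have h1 := variance_eval_multivariateGaussian (μ := (0 : Vec p)) h.cov_posSemidef l
  rw [← h.law_b i, variance_map (by fun_prop) (h.measurable_b i).aemeasurable] at h1
  exact h1

lemma lintegral_sq_eq_variance [IsProbabilityMeasure μ] {f : Ω → ℝ} (hf : MemLp f 2 μ)
    (h0 : ∫ ω, f ω ∂μ = 0) : ∫⁻ ω, ENNReal.ofReal (f ω ^ 2) ∂μ = ENNReal.ofReal (Var[f; μ]) := by
  rw [variance_of_integral_eq_zero hf.aemeasurable h0,
    ofReal_integral_eq_lintegral_ofReal hf.integrable_sq (ae_of_all _ fun _ => sq_nonneg _)]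

lemma le_trace_G (h : IsGLMM S μ) (l : Fin p) : S.G l l ≤ S.G.trace :=
  Finset.single_le_sum (f := fun l => S.G l l) (fun _ _ => h.cov_posSemidef.diag_nonneg)
    (Finset.mem_univ l)

lemma integral_norm_b_le [IsProbabilityMeasure μ] (h : IsGLMM S μ) (i : ℕ) :
    Integrable (fun ω => ‖S.b i ω‖) μ ∧ ∫ ω, ‖S.b i ω‖ ∂μ ≤ p * √S.G.trace := by
  refine integrable_norm_of_lintegral_sq_le (h.measurable_b i) h.cov_posSemidef.trace_nonneg
    fun l => ?_
  rw [lintegral_sq_eq_variance (memLp_b h i l) (integral_b h i l), variance_b h]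
  exact ENNReal.ofReal_le_ofReal (le_trace_G h l)

/-- Independence of the clusters adds the variances, so averaging gains the factor `1 / m`. -/
lemma integral_norm_mean_b_le [IsProbabilityMeasure μ] (h : IsGLMM S μ) {k : ℕ} (hk : 0 < S.m k) :
    Integrable (fun ω => ‖(S.m k : ℝ)⁻¹ • ∑ i : Fin (S.m k), S.b i ω‖) μ ∧
      ∫ ω, ‖(S.m k : ℝ)⁻¹ • ∑ i : Fin (S.m k), S.b i ω‖ ∂μ ≤ p * √((S.m k : ℝ)⁻¹ * S.G.trace) := by
  have hm := h.measurable_b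
  have htr := h.cov_posSemidef.trace_nonneg
  refine integrable_norm_of_lintegral_sq_le (by fun_prop) (by positivity) fun l => ?_
  have hs : MemLp (fun ω => ∑ i : Fin (S.m k), S.b i ω l) 2 μ :=
    memLp_finsetSum _ fun i _ => memLp_b h i l
  have e : ∀ ω, ((S.m k : ℝ)⁻¹ • ∑ i : Fin (S.m k), S.b i ω) l =
      (S.m k : ℝ)⁻¹ * ∑ i : Fin (S.m k), S.b i ω l := by intro ω; simp
  simp only [e]
  rw [lintegral_sq_eq_variance (hs.const_mul _)]
  · refine ENNReal.ofReal_le_ofReal ?_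
    rw [variance_const_mul]
    have hv : Var[∑ i : Fin (S.m k), fun ω => S.b i ω l; μ] = ∑ _i : Fin (S.m k), S.G l l := by
      rw [IndepFun.variance_sum (fun (i : Fin (S.m k)) _ => memLp_b h i l)]
      · simp [variance_b h]
      · intro i _ j _ hij
        have hind := (h.indep_clusters k).indepFun hij
        exact hind.comp (φ := fun z => z.1 l) (ψ := fun z => z.1 l) (by fun_prop) (by fun_prop)
    have e2 : (∑ i : Fin (S.m k), fun ω => S.b i ω l) = fun ω => ∑ i : Fin (S.m k), S.b i ω l := by
      ext; simp
    rw [e2] at hv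
    rw [hv]
    simp only [Finset.sum_const, Finset.card_univ, Fintype.card_fin, nsmul_eq_mul]
    have : (S.m k : ℝ) ≠ 0 := by positivity
    calc _ = (S.m k : ℝ)⁻¹ * S.G l l := by field_simp
      _ ≤ _ := mul_le_mul_of_nonneg_left (le_trace_G h l) (by positivity)
  · rw [integral_const_mul, integral_finsetSum _ fun (i : Fin (S.m k)) _ =>
      (memLp_b h i l).integrable (by norm_num)]
    simp [integral_b h]

end Model

/-! ### Rayleigh quotients and traces -/

section LinearAlgebra

variable {p : ℕ}

/-- The Rayleigh quotient of an invertible positive semidefinite matrix is at least the inverse of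
the trace of its inverse. -/
lemma dotProduct_self_le_trace_inv_mul {M : Matrix (Fin p) (Fin p) ℝ} (hM : M.PosSemidef)
    (hu : IsUnit M) (v : Fin p → ℝ) : v ⬝ᵥ v ≤ (M⁻¹).trace * (v ⬝ᵥ (M *ᵥ v)) := by
  have hdet := (Matrix.isUnit_iff_isUnit_det M).1 hu
  -- Factor `M⁻¹ = Cᵀ C` and put `z = C M v`. Then `v = Cᵀ z` and `vᵀ M v = zᵀ z`, and
  -- Cauchy–Schwarz in each coordinate of `Cᵀ z` gives the claim, the trace being the sum of squares
  -- of the entries of `C`.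
  obtain ⟨r, u, hu'⟩ := Matrix.posSemidef_iff_eq_sum_vecMulVec.1 hM.inv
  let C : Matrix (Fin r) (Fin p) ℝ := Matrix.of u
  have hC : M⁻¹ = Cᵀ * C := by
    rw [hu']
    ext l l'
    simp [C, Matrix.sum_apply, Matrix.mul_apply, Matrix.vecMulVec_apply]
  have hv : v = Cᵀ *ᵥ (C *ᵥ (M *ᵥ v)) := by
    rw [Matrix.mulVec_mulVec, ← hC, Matrix.mulVec_mulVec, Matrix.nonsing_inv_mul _ hdet,
      Matrix.one_mulVec]
  set z := C *ᵥ (M *ᵥ v) with hz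
  have h1 : v ⬝ᵥ (M *ᵥ v) = z ⬝ᵥ z := by
    calc v ⬝ᵥ (M *ᵥ v) = (Cᵀ *ᵥ z) ⬝ᵥ (M *ᵥ v) := congrArg (· ⬝ᵥ (M *ᵥ v)) hv
      _ = z ⬝ᵥ z := by rw [Matrix.mulVec_transpose, ← Matrix.dotProduct_mulVec]
  have h2 : (M⁻¹).trace = ∑ l, ∑ r, C r l ^ 2 := by
    rw [hC]
    simp [Matrix.trace, Matrix.mul_apply, sq]
  rw [h1, h2, hv]
  simp only [dotProduct, Matrix.mulVec, Matrix.transpose_apply, ← sq]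
  rw [Finset.sum_mul]
  exact Finset.sum_le_sum fun l _ => Finset.sum_mul_sq_le_sq_mul_sq _ _ _

lemma trace_le_of_spectrum_subset {K : Matrix (Fin p) (Fin p) ℝ} (hK : K.PosDef) {c : ℝ}
    (h : spectrum ℝ K ⊆ Set.Icc c c⁻¹) : K.trace ≤ p * c⁻¹ := by
  rw [hK.isHermitian.trace_eq_sum_eigenvalues]
  calc _ ≤ ∑ _l : Fin p, c⁻¹ := Finset.sum_le_sum fun l _ =>
        (h (hK.isHermitian.eigenvalues_mem_spectrum_real l)).2
    _ = _ := by simp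

/-- The sum of the absolute values of the entries of a matrix. -/
def entrySum (P : Matrix (Fin p) (Fin p) ℝ) : ℝ := ∑ l, ∑ l', |P l l'|

lemma entrySum_nonneg (P : Matrix (Fin p) (Fin p) ℝ) : 0 ≤ entrySum P :=
  Finset.sum_nonneg fun _ _ => Finset.sum_nonneg fun _ _ => abs_nonneg _

lemma abs_dotProduct_mulVec_le (P : Matrix (Fin p) (Fin p) ℝ) (u v : Vec p) :
    |u.ofLp ⬝ᵥ (P *ᵥ v.ofLp)| ≤ entrySum P * (‖u‖ * ‖v‖) := by
  have hn : ∀ (w : Vec p) l, |w l| ≤ ‖w‖ := fun w l => by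
    simpa using PiLp.norm_apply_le w l
  simp only [dotProduct, Matrix.mulVec, entrySum, Finset.sum_mul, Finset.mul_sum]
  refine (Finset.abs_sum_le_sum_abs _ _).trans (Finset.sum_le_sum fun l _ => ?_)
  refine (Finset.abs_sum_le_sum_abs _ _).trans (Finset.sum_le_sum fun l' _ => ?_)
  rw [abs_mul, abs_mul, mul_left_comm]
  gcongr <;> apply hn

end LinearAlgebra

/-! ### Consequences of maximality of the PQL objective -/

section Optimality

variable {p : ℕ} {a : ℝ → ℝ} {c : ℝ → ℝ → ℝ} {φ : ℝ} {G : Matrix (Fin p) (Fin p) ℝ}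
  {m : ℕ} {n : ℕ → ℕ} {x : ℕ → ℕ → Vec p} {y : ℕ → ℕ → ℝ} {β : Vec p} {b : Fin m → Vec p}

lemma linPred_add_sub (x β b v : Vec p) : linPred x (β + v) (b - v) = linPred x β b := by
  simp [linPred, inner_add_right, inner_sub_right]

/-- Every covariate being a fixed and a random effect covariate, the predicted random effects are
centred. -/
lemma sum_eq_zero_of_isMax (hG : G.PosDef)
    (hmax : ∀ θ, objective a c φ G m n x y θ ≤ objective a c φ G m n x y (β, b)) :
    ∑ i, b i = 0 := by
  rcases Nat.eq_zero_or_pos m with rfl | hm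
  · simp
  have hP := hG.inv
  set v : Vec p := (m : ℝ)⁻¹ • ∑ i, b i with hv
  have hm' : (m : ℝ) ≠ 0 := by positivity
  have hsum : ∑ i, b i = (m : ℝ) • v := by rw [hv, smul_smul, mul_inv_cancel₀ hm', one_smul]
  -- Recentring the `b i` at their mean `v` keeps every linear predictor and lowers the quadratic
  -- form summed over clusters by `m vᵀ G⁻¹ v`, which is positive unless `v = 0`.
  have h1 := hmax (β + v, fun i => b i - v)
  simp only [objective, linPred_add_sub] at h1
  have hsymm : ∀ u w : Vec p, u.ofLp ⬝ᵥ (G⁻¹ *ᵥ w.ofLp) = w.ofLp ⬝ᵥ (G⁻¹ *ᵥ u.ofLp) := by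
    intro u w
    have ht : (G⁻¹)ᵀ = G⁻¹ := by simpa using hP.isHermitian.eq
    rw [Matrix.dotProduct_mulVec, dotProduct_comm, ← Matrix.mulVec_transpose, ht]
  have hexp : ∀ i, (b i - v).ofLp ⬝ᵥ (G⁻¹ *ᵥ (b i - v).ofLp) =
      (b i).ofLp ⬝ᵥ (G⁻¹ *ᵥ (b i).ofLp) - 2 * (v.ofLp ⬝ᵥ (G⁻¹ *ᵥ (b i).ofLp)) +
        v.ofLp ⬝ᵥ (G⁻¹ *ᵥ v.ofLp) := by
    intro i
    simp only [WithLp.ofLp_sub, Matrix.mulVec_sub, sub_dotProduct, dotProduct_sub, hsymm (b i) v]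
    ring
  have hlin : ∑ i, v.ofLp ⬝ᵥ (G⁻¹ *ᵥ (b i).ofLp) = m * (v.ofLp ⬝ᵥ (G⁻¹ *ᵥ v.ofLp)) := by
    rw [← dotProduct_sum, ← Matrix.mulVec_sum, ← WithLp.ofLp_sum, hsum]
    simp [Matrix.mulVec_smul]
  simp only [hexp, Finset.sum_add_distrib, Finset.sum_sub_distrib, ← Finset.mul_sum, hlin,
    Finset.sum_const, Finset.card_univ, Fintype.card_fin, nsmul_eq_mul] at h1
  by_contra hne
  have hv0 : v.ofLp ≠ 0 := by
    intro h0
    apply hne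
    rw [hsum, show v = 0 from by ext l; simpa using congrFun h0 l, smul_zero]
  have hpos : 0 < v.ofLp ⬝ᵥ (G⁻¹ *ᵥ v.ofLp) := by simpa using hP.dotProduct_mulVec_pos hv0
  have : 0 < (m : ℝ) * (v.ofLp ⬝ᵥ (G⁻¹ *ᵥ v.ofLp)) := by positivity
  linarith

lemma sum_update_sub_sum {ι E : Type*} [Fintype ι] [DecidableEq ι] (F : ι → E → ℝ) (b : ι → E)
    (i₀ : ι) (z : E) :
    ∑ i, F i (Function.update b i₀ z i) - ∑ i, F i (b i) = F i₀ z - F i₀ (b i₀) := by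
  rw [← Finset.sum_sub_distrib, Finset.sum_eq_single i₀]
  · simp
  · intro i _ hi
    simp [Function.update_of_ne hi]
  · simp

/-- The score equation of a cluster, in the direction `v`. -/
lemma score_eq_of_isMax (ha : Differentiable ℝ a) (hG : G.PosDef)
    (hmax : ∀ θ, objective a c φ G m n x y θ ≤ objective a c φ G m n x y (β, b)) (i : Fin m)
    (v : Vec p) :
    ∑ j ∈ Finset.range (n i), φ⁻¹ * ((y i j - deriv a (linPred (x i j) β (b i))) *
      inner ℝ (x i j) v) = v.ofLp ⬝ᵥ (G⁻¹ *ᵥ (b i).ofLp) := by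
  have hsymm : (b i).ofLp ⬝ᵥ (G⁻¹ *ᵥ v.ofLp) = v.ofLp ⬝ᵥ (G⁻¹ *ᵥ (b i).ofLp) := by
    have ht : (G⁻¹)ᵀ = G⁻¹ := by simpa using hG.inv.isHermitian.eq
    rw [Matrix.dotProduct_mulVec, dotProduct_comm, ← Matrix.mulVec_transpose, ht]
  -- For fixed `β` the objective is a sum over clusters, so varying one `b i` along the line in
  -- direction `v` involves a single summand, and its derivative vanishes at the maximum.
  let F : Fin m → Vec p → ℝ := fun i w =>
    (∑ j ∈ Finset.range (n i), Real.log (density a c φ (linPred (x i j) β w) (y i j)))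
      - 1 / 2 * (w.ofLp ⬝ᵥ (G⁻¹ *ᵥ w.ofLp))
  have hobj : ∀ w : Fin m → Vec p, objective a c φ G m n x y (β, w) = ∑ i, F i (w i) := by
    intro w
    simp only [objective, F, Finset.sum_sub_distrib, Finset.mul_sum]
  let f : ℝ → ℝ := fun t => F i (b i + t • v)
  have hf : ∀ t, f t ≤ f 0 := by
    intro t
    have h1 := hmax (β, Function.update b i (b i + t • v))
    rw [hobj, hobj] at h1
    have h2 := sum_update_sub_sum F b i (b i + t • v)
    simp only [f, zero_smul, add_zero]
    linarith
  have hlin : ∀ j t, linPred (x i j) β (b i + t • v) =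
      linPred (x i j) β (b i) + inner ℝ (x i j) v * t := by
    intro j t
    simp only [linPred, inner_add_right, inner_smul_right]
    ring
  have hquad : ∀ t : ℝ, (b i + t • v).ofLp ⬝ᵥ (G⁻¹ *ᵥ (b i + t • v).ofLp) =
      (b i).ofLp ⬝ᵥ (G⁻¹ *ᵥ (b i).ofLp) + t * (2 * (v.ofLp ⬝ᵥ (G⁻¹ *ᵥ (b i).ofLp))) +
        t ^ 2 * (v.ofLp ⬝ᵥ (G⁻¹ *ᵥ v.ofLp)) := by
    intro t
    simp only [WithLp.ofLp_add, WithLp.ofLp_smul, Matrix.mulVec_add, Matrix.mulVec_smul,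
      add_dotProduct, dotProduct_add, smul_dotProduct, dotProduct_smul, hsymm, smul_eq_mul]
    ring
  have hder : HasDerivAt f ((∑ j ∈ Finset.range (n i),
      φ⁻¹ * ((y i j - deriv a (linPred (x i j) β (b i))) * inner ℝ (x i j) v)) -
        1 / 2 * (2 * (v.ofLp ⬝ᵥ (G⁻¹ *ᵥ (b i).ofLp)))) 0 := by
    simp only [f, F, density, Real.log_exp, hlin, hquad]
    refine HasDerivAt.fun_sub (HasDerivAt.fun_sum fun j _ => ?_) (HasDerivAt.const_mul _ ?_)
    · have h1 := hasDerivAt_comp_affine ha (linPred (x i j) β (b i)) (inner ℝ (x i j) v) 0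
      have h2 : HasDerivAt (fun t => linPred (x i j) β (b i) + inner ℝ (x i j) v * t)
          (inner ℝ (x i j) v) 0 := by
        simpa using ((hasDerivAt_id (0 : ℝ)).const_mul (inner ℝ (x i j) v)).const_add
          (linPred (x i j) β (b i))
      have h3 := (((h2.const_mul (y i j)).fun_sub h1).const_mul φ⁻¹).add_const (c (y i j) φ)
      refine h3.congr_deriv ?_
      simp only [mul_zero, add_zero]
      ring
    · have h1 : HasDerivAt (fun t : ℝ => t * (2 * (v.ofLp ⬝ᵥ (G⁻¹ *ᵥ (b i).ofLp))))
          (2 * (v.ofLp ⬝ᵥ (G⁻¹ *ᵥ (b i).ofLp))) 0 := by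
        simpa using (hasDerivAt_id (0 : ℝ)).mul_const (2 * (v.ofLp ⬝ᵥ (G⁻¹ *ᵥ (b i).ofLp)))
      have h2 : HasDerivAt (fun t : ℝ => t ^ 2 * (v.ofLp ⬝ᵥ (G⁻¹ *ᵥ v.ofLp))) 0 0 := by
        simpa using (hasDerivAt_pow 2 (0 : ℝ)).mul_const (v.ofLp ⬝ᵥ (G⁻¹ *ᵥ v.ofLp))
      simpa using (h1.const_add ((b i).ofLp ⬝ᵥ (G⁻¹ *ᵥ (b i).ofLp))).fun_add h2
  have h0 := IsLocalMax.hasDerivAt_eq_zero (Eventually.of_forall hf) hder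
  linarith

/-- Strong monotonicity of `a'`: the function `a' - c₀ · id` has nonnegative derivative. Being
global, it requires no prior localisation of the estimator. -/
lemma mul_sq_le_deriv_sub_mul (ha : ContDiff ℝ 2 a) {c₀ : ℝ}
    (h : ∀ η, c₀ ≤ iteratedDeriv 2 a η) (s t : ℝ) :
    c₀ * (s - t) ^ 2 ≤ (deriv a s - deriv a t) * (s - t) := by
  have hdd : Differentiable ℝ (deriv a) :=
    (ContDiff.iterate_deriv' 1 1 (by simpa using ha)).differentiable (by norm_num)
  have hmono : Monotone fun u => deriv a u - c₀ * u := by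
    have hD : ∀ u, HasDerivAt (fun u => deriv a u - c₀ * u) (deriv (deriv a) u - c₀) u :=
      fun u => by
      simpa using (hdd u).hasDerivAt.fun_sub ((hasDerivAt_id u).const_mul c₀)
    refine monotone_of_deriv_nonneg (fun u => (hD u).differentiableAt) fun u => ?_
    rw [(hD u).deriv]
    have := h u
    rw [iteratedDeriv_succ, iteratedDeriv_one] at this
    linarith
  rcases le_total s t with hst | hst
  · have := hmono hst
    simp only at this
    nlinarith
  · have := hmono hst
    simp only at this
    nlinarith

end Optimality

/-! ### Deterministic error bound within a cluster -/

section Cluster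

variable {p : ℕ} {Ω : Type*} {S : GLMMSeq p Ω}

/-- The Gram form `|X_i v|²` of the design of cluster `i`. -/
def gram (S : GLMMSeq p Ω) (k i : ℕ) (v : Vec p) : ℝ :=
  ∑ j : Fin (S.n k i), inner ℝ (S.x k i j) v ^ 2

lemma gram_nonneg (k i : ℕ) (v : Vec p) : 0 ≤ gram S k i v :=
  Finset.sum_nonneg fun _ _ => sq_nonneg _

/-- The reciprocal of the smallest eigenvalue of `n_i⁻¹ X_iᵀ X_i`. -/
def invMinEig (S : GLMMSeq p Ω) (k i : ℕ) : ℝ :=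
  ⨆ v : Vec p, S.n k i * ‖v‖ ^ 2 / gram S k i v

lemma invMinEig_nonneg (k i : ℕ) : 0 ≤ invMinEig S k i :=
  Real.iSup_nonneg fun v => div_nonneg (by positivity) (gram_nonneg k i v)

/-- The error of the sum of fixed and random effects of cluster `i`. -/
def totalError (S : GLMMSeq p Ω) (k : ℕ) (ω : Ω) (i : Fin (S.m k)) : Vec p :=
  (S.βhat k ω + S.bhat k ω i) - (S.β + S.b i ω)

/-- The size of the penalty relative to the log-likelihood. -/
def penalty (S : GLMMSeq p Ω) (k : ℕ) (ω : Ω) : ℝ := S.φhat k ω * entrySum (S.Ghat k ω)⁻¹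

lemma inner_score (k i : ℕ) (ω : Ω) (v : Vec p) :
    inner ℝ (score S k i ω) v = ∑ j : Fin (S.n k i),
      (S.y k i j ω - deriv S.a (S.eta k i j ω)) * inner ℝ (S.x k i j) v := by
  simp only [PiLp.inner_apply, score_apply, RCLike.inner_apply, conj_trivial, Finset.mul_sum]
  rw [Finset.sum_comm]
  exact Finset.sum_congr rfl fun j _ => Finset.sum_congr rfl fun l _ => by ring

/-- The score equation is tested with the error δ itself. Strong monotonicity turns the difference
of means into the Gram form. With `bhat = b + δ - Δ`, where Δ is the error of `βhat`, the penalty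
contributes a quadratic form in δ of favourable sign, which is dropped, and cross terms with `b` and
Δ. -/
lemma gram_totalError_le (ha : ContDiff ℝ 2 S.a) {c₀ : ℝ}
    (hc₀ : ∀ η, c₀ ≤ iteratedDeriv 2 S.a η) {k : ℕ} {ω : Ω} (hG : (S.Ghat k ω).PosDef)
    (hφ : 0 < S.φhat k ω)
    (hmax : ∀ θ : Vec p × (Fin (S.m k) → Vec p),
      objective S.a S.c (S.φhat k ω) (S.Ghat k ω) (S.m k) (S.n k) (S.x k)
        (fun i j => S.y k i j ω) θ ≤
      objective S.a S.c (S.φhat k ω) (S.Ghat k ω) (S.m k) (S.n k) (S.x k)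
        (fun i j => S.y k i j ω) (S.βhat k ω, S.bhat k ω)) (i : Fin (S.m k)) :
    c₀ * gram S k i (totalError S k ω i) ≤ ‖totalError S k ω i‖ *
      (‖score S k i ω‖ + penalty S k ω * (‖S.b i ω‖ + ‖S.βhat k ω - S.β‖)) := by
  set δ := totalError S k ω i with hδ
  set Δ := S.βhat k ω - S.β with hΔ
  have hd : Differentiable ℝ S.a := ha.differentiable (by norm_num)
  have h1 := score_eq_of_isMax hd hG hmax i δ
  rw [Finset.sum_range (fun j => (S.φhat k ω)⁻¹ * ((S.y k i j ω -
    deriv S.a (linPred (S.x k i j) (S.βhat k ω) (S.bhat k ω i))) * inner ℝ (S.x k i j) δ)),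
    ← Finset.mul_sum, inv_mul_eq_iff_eq_mul₀ hφ.ne'] at h1
  have hb : S.bhat k ω i = S.b i ω + δ - Δ := by
    simp only [hδ, hΔ, totalError]; abel
  have hη : ∀ j, linPred (S.x k i j) (S.βhat k ω) (S.bhat k ω i) - S.eta k i j ω =
      inner ℝ (S.x k i j) δ := by
    intro j
    simp only [hδ, totalError, GLMMSeq.eta, linPred, inner_sub_right, inner_add_right]
  have h2 : c₀ * gram S k i δ ≤ inner ℝ (score S k i ω) δ -
      ∑ j : Fin (S.n k i), (S.y k i j ω - deriv S.a (linPred (S.x k i j) (S.βhat k ω)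
        (S.bhat k ω i))) * inner ℝ (S.x k i j) δ := by
    rw [inner_score, ← Finset.sum_sub_distrib, gram, Finset.mul_sum]
    refine Finset.sum_le_sum fun j _ => ?_
    have h3 := mul_sq_le_deriv_sub_mul ha hc₀
      (linPred (S.x k i j) (S.βhat k ω) (S.bhat k ω i)) (S.eta k i j ω)
    rw [hη] at h3
    linarith
  rw [h1] at h2
  have hquad : δ.ofLp ⬝ᵥ ((S.Ghat k ω)⁻¹ *ᵥ (S.bhat k ω i).ofLp) =
      δ.ofLp ⬝ᵥ ((S.Ghat k ω)⁻¹ *ᵥ (S.b i ω).ofLp) + δ.ofLp ⬝ᵥ ((S.Ghat k ω)⁻¹ *ᵥ δ.ofLp) -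
        δ.ofLp ⬝ᵥ ((S.Ghat k ω)⁻¹ *ᵥ Δ.ofLp) := by
    rw [hb]
    simp [Matrix.mulVec_sub, Matrix.mulVec_add, dotProduct_sub, dotProduct_add]
  have hpos : 0 ≤ δ.ofLp ⬝ᵥ ((S.Ghat k ω)⁻¹ *ᵥ δ.ofLp) := by
    simpa using hG.inv.posSemidef.dotProduct_mulVec_nonneg δ.ofLp
  have hb1 := neg_le_of_abs_le (abs_dotProduct_mulVec_le (S.Ghat k ω)⁻¹ δ (S.b i ω))
  have hb2 := le_of_abs_le (abs_dotProduct_mulVec_le (S.Ghat k ω)⁻¹ δ Δ)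
  have hs := real_inner_le_norm (score S k i ω) δ
  have h4 : -(entrySum (S.Ghat k ω)⁻¹ * (‖δ‖ * (‖S.b i ω‖ + ‖Δ‖))) ≤
      δ.ofLp ⬝ᵥ ((S.Ghat k ω)⁻¹ *ᵥ (S.bhat k ω i).ofLp) := by
    rw [hquad]; linarith
  have h5 := mul_le_mul_of_nonneg_left h4 hφ.le
  simp only [penalty]
  linarith

lemma norm_totalError_le {c₀ : ℝ} (hc₀ : 0 < c₀) {k : ℕ} {ω : Ω} {i : Fin (S.m k)} {R : ℝ}
    (hn : 0 < S.n k i) (hR : 0 ≤ R)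
    (hL : S.n k i * ‖totalError S k ω i‖ ^ 2 ≤
      invMinEig S k i * gram S k i (totalError S k ω i))
    (h : c₀ * gram S k i (totalError S k ω i) ≤ ‖totalError S k ω i‖ * R) :
    ‖totalError S k ω i‖ ≤ invMinEig S k i * R / (c₀ * S.n k i) := by
  have hn' : (0 : ℝ) < S.n k i := by exact_mod_cast hn
  have hL0 := invMinEig_nonneg (S := S) k i
  -- One factor of the error norm is to be cancelled, so a vanishing error is treated apart.
  rcases (norm_nonneg (totalError S k ω i)).eq_or_lt with h0 | h0
  · rw [← h0]; positivity
  rw [le_div_iff₀ (by positivity)]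
  have h1 : c₀ * (S.n k i * ‖totalError S k ω i‖ ^ 2) ≤
      invMinEig S k i * (‖totalError S k ω i‖ * R) :=
    calc _ ≤ c₀ * (invMinEig S k i * gram S k i (totalError S k ω i)) := by gcongr
      _ = invMinEig S k i * (c₀ * gram S k i (totalError S k ω i)) := by ring
      _ ≤ _ := by gcongr
  refine le_of_mul_le_mul_left ?_ h0
  linarith

lemma dotProduct_info (k i : ℕ) (ω : Ω) (v : Vec p) :
    v.ofLp ⬝ᵥ (S.info k i ω *ᵥ v.ofLp) = (S.φhat k ω)⁻¹ *
      ∑ j : Fin (S.n k i), iteratedDeriv 2 S.a (S.eta k i j ω) * inner ℝ (S.x k i j) v ^ 2 := by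
  have hX : ∀ j, (S.X k i *ᵥ v.ofLp) j = inner ℝ (S.x k i j) v := by
    intro j
    simp [Matrix.mulVec, dotProduct, GLMMSeq.X, PiLp.inner_apply, mul_comm]
  rw [GLMMSeq.info, ← Matrix.mulVec_mulVec, ← Matrix.mulVec_mulVec, Matrix.mulVec_transpose,
    dotProduct_comm, ← Matrix.dotProduct_mulVec, dotProduct_comm, GLMMSeq.W, Matrix.smul_mulVec,
    dotProduct_smul, smul_eq_mul, dotProduct]
  simp only [Matrix.mulVec_diagonal, hX]
  congr 1
  exact Finset.sum_congr rfl fun j _ => by ring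

lemma posSemidef_info {k i : ℕ} {ω : Ω} (hφ : 0 < S.φhat k ω)
    (ha : ∀ η, 0 ≤ iteratedDeriv 2 S.a η) : (S.info k i ω).PosSemidef := by
  have hW : (S.W k i ω).PosSemidef :=
    (Matrix.PosSemidef.diagonal fun j => ha _).smul (inv_nonneg.2 hφ.le)
  simpa [GLMMSeq.info] using hW.conjTranspose_mul_mul_same (S.X k i)

lemma posSemidef_H {k i : ℕ} {ω : Ω} (hφ : 0 < S.φhat k ω) (hφ' : 0 < S.φ)
    (ha : ∀ η, 0 ≤ iteratedDeriv 2 S.a η) : (S.H k i ω).PosSemidef :=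
  ((posSemidef_info hφ ha).smul (by positivity)).inv

/-- The random weights in `H_i` are at most `c₀⁻¹` and the working dispersion cancels, so the trace
of `H_i` controls the non-random Gram matrix. -/
lemma norm_sq_le_trace_H_mul_gram {c₀ : ℝ} (hc₀ : 0 < c₀)
    (ha : ∀ η, 0 ≤ iteratedDeriv 2 S.a η) (ha' : ∀ η, iteratedDeriv 2 S.a η ≤ c₀⁻¹)
    {k i : ℕ} {ω : Ω} (hn : 0 < S.n k i) (hφ : 0 < S.φhat k ω) (hφ' : 0 < S.φ)
    (hu : IsUnit (S.info k i ω)) (v : Vec p) :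
    S.n k i * ‖v‖ ^ 2 ≤ (c₀ * S.φ)⁻¹ * (S.H k i ω).trace * gram S k i v := by
  have hn' : (0 : ℝ) < S.n k i := by exact_mod_cast hn
  have hr : 0 < (S.n k i : ℝ)⁻¹ * S.φhat k ω * S.φ⁻¹ := by positivity
  have hu' : IsUnit (((S.n k i : ℝ)⁻¹ * S.φhat k ω * S.φ⁻¹) • S.info k i ω) := by
    have := hu.smul (Units.mk0 _ hr.ne')
    simpa [Units.smul_def] using this
  have h1 := dotProduct_self_le_trace_inv_mul ((posSemidef_info hφ ha).smul hr.le) hu' v.ofLp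
  have hv : v.ofLp ⬝ᵥ v.ofLp = ‖v‖ ^ 2 := by
    rw [EuclideanSpace.real_norm_sq_eq, dotProduct]; simp [sq]
  rw [hv, Matrix.smul_mulVec, dotProduct_smul, dotProduct_info, smul_eq_mul] at h1
  have htr : 0 ≤ (S.H k i ω).trace := (posSemidef_H hφ hφ' ha).trace_nonneg
  have h2 : ∑ j : Fin (S.n k i), iteratedDeriv 2 S.a (S.eta k i j ω) * inner ℝ (S.x k i j) v ^ 2 ≤
      c₀⁻¹ * gram S k i v := by
    rw [gram, Finset.mul_sum]
    exact Finset.sum_le_sum fun j _ => mul_le_mul_of_nonneg_right (ha' _) (sq_nonneg _)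
  change ‖v‖ ^ 2 ≤ (S.H k i ω).trace * _ at h1
  calc _ ≤ S.n k i * ((S.H k i ω).trace * ((S.n k i : ℝ)⁻¹ * S.φhat k ω * S.φ⁻¹ *
        ((S.φhat k ω)⁻¹ * (c₀⁻¹ * gram S k i v)))) := by
        refine mul_le_mul_of_nonneg_left (h1.trans ?_) hn'.le
        gcongr
    _ = _ := by field_simp

/-- The hypothesis makes the supremum finite, a real supremum of an unbounded set being 0 by
convention. It also forces the left side to vanish where the Gram form does, so division by zero
does no harm. -/
lemma le_invMinEig_mul_gram {k i : ℕ} {T : ℝ}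
    (h : ∀ v, S.n k i * ‖v‖ ^ 2 ≤ T * gram S k i v) (v : Vec p) :
    S.n k i * ‖v‖ ^ 2 ≤ invMinEig S k i * gram S k i v := by
  rcases (gram_nonneg (S := S) k i v).eq_or_lt with h0 | h0
  · have := h v
    rw [← h0, mul_zero] at this ⊢
    exact this
  rw [← div_le_iff₀ h0]
  refine le_ciSup (f := fun v : Vec p => S.n k i * ‖v‖ ^ 2 / gram S k i v) ⟨max T 0, ?_⟩ v
  rintro _ ⟨w, rfl⟩
  rcases (gram_nonneg (S := S) k i w).eq_or_lt with h1 | h1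
  · simp [← h1]
  · exact ((div_le_iff₀ h1).2 (h w)).trans (le_max_left _ _)

lemma invMinEig_le {k i : ℕ} {T : ℝ} (hT : 0 ≤ T)
    (h : ∀ v, S.n k i * ‖v‖ ^ 2 ≤ T * gram S k i v) : invMinEig S k i ≤ T := by
  refine Real.iSup_le (fun v => ?_) hT
  exact div_le_of_le_mul₀ (gram_nonneg _ _ _) hT (h v)

end Cluster

/-! ### Calculus of stochastic order -/

section InProbability

variable {Ω : Type*} [MeasurableSpace Ω] {μ : Measure Ω}

lemma BoundedInProbability.of_forall_le {Z Z₁ Z₂ : ℕ → Ω → ℝ} (h₁ : BoundedInProbability μ Z₁)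
    (h₂ : BoundedInProbability μ Z₂)
    (h : ∀ M₁ M₂ : ℝ, ∃ M : ℝ, ∀ k ω, |Z₁ k ω| ≤ M₁ → |Z₂ k ω| ≤ M₂ → |Z k ω| ≤ M) :
    BoundedInProbability μ Z := by
  intro ε hε
  obtain ⟨M₁, hM₁⟩ := h₁ (ε / 2) (ENNReal.half_pos hε.ne')
  obtain ⟨M₂, hM₂⟩ := h₂ (ε / 2) (ENNReal.half_pos hε.ne')
  obtain ⟨M, hM⟩ := h M₁ M₂
  refine ⟨M, ?_⟩
  filter_upwards [hM₁, hM₂] with k h1 h2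
  calc μ {ω | M < |Z k ω|} ≤ μ ({ω | M₁ < |Z₁ k ω|} ∪ {ω | M₂ < |Z₂ k ω|}) := by
        refine measure_mono fun ω hω => ?_
        by_contra hcon
        simp only [Set.mem_union, Set.mem_ofPred_eq, not_or, not_lt] at hcon hω
        exact absurd (hM k ω hcon.1 hcon.2) (not_le.2 hω)
    _ ≤ ε / 2 + ε / 2 := (measure_union_le _ _).trans (add_le_add h1 h2)
    _ = ε := ENNReal.add_halves ε

lemma BoundedInProbability.add {Z₁ Z₂ : ℕ → Ω → ℝ} (h₁ : BoundedInProbability μ Z₁)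
    (h₂ : BoundedInProbability μ Z₂) : BoundedInProbability μ fun k ω => Z₁ k ω + Z₂ k ω :=
  .of_forall_le h₁ h₂ fun M₁ M₂ =>
    ⟨M₁ + M₂, fun _ _ h1 h2 => (abs_add_le _ _).trans (add_le_add h1 h2)⟩

lemma BoundedInProbability.mul {Z₁ Z₂ : ℕ → Ω → ℝ} (h₁ : BoundedInProbability μ Z₁)
    (h₂ : BoundedInProbability μ Z₂) : BoundedInProbability μ fun k ω => Z₁ k ω * Z₂ k ω :=
  .of_forall_le h₁ h₂ fun M₁ M₂ => ⟨M₁ * M₂, fun _ _ h1 h2 => by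
    rw [abs_mul]
    exact mul_le_mul h1 h2 (abs_nonneg _) ((abs_nonneg _).trans h1)⟩

lemma BoundedInProbability.abs {Z : ℕ → Ω → ℝ} (h : BoundedInProbability μ Z) :
    BoundedInProbability μ fun k ω => |Z k ω| := by
  simpa [BoundedInProbability] using h

lemma BoundedInProbability.sum {ι : Type*} {Z : ι → ℕ → Ω → ℝ} (s : Finset ι)
    (h : ∀ i ∈ s, BoundedInProbability μ (Z i)) :
    BoundedInProbability μ fun k ω => ∑ i ∈ s, Z i k ω := by
  classical
  induction s using Finset.induction_on with
  | empty => exact fun ε _ => ⟨0, by simp⟩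
  | insert i s hi ih =>
    simp only [Finset.sum_insert hi]
    exact (h i (by simp)).add (ih fun j hj => h j (by simp [hj]))

lemma tendstoInMeasure_sum {ι E : Type*} [SeminormedAddCommGroup E] (s : Finset ι)
    {f : ι → ℕ → Ω → E} {g : ι → Ω → E} (h : ∀ i ∈ s, TendstoInMeasure μ (f i) atTop (g i)) :
    TendstoInMeasure μ (fun k ω => ∑ i ∈ s, f i k ω) atTop (fun ω => ∑ i ∈ s, g i ω) := by
  rw [tendstoInMeasure_iff_norm]
  intro ε hε
  -- Splitting `ε` into `card + 1` shares, instead of `card`, covers the empty sum and makes the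
  -- final inequality strict.
  have hc : (0 : ℝ) < s.card + 1 := by positivity
  have hlim : Tendsto (fun k => ∑ i ∈ s, μ {ω | ε / (s.card + 1) ≤ ‖f i k ω - g i ω‖}) atTop
      (𝓝 0) := by
    have := tendsto_finsetSum s fun i hi =>
      (tendstoInMeasure_iff_norm.1 (h i hi)) (ε / (s.card + 1)) (by positivity)
    simpa using this
  refine tendsto_of_tendsto_of_tendsto_of_le_of_le tendsto_const_nhds hlim (fun _ => zero_le)
    fun k => ?_
  refine (measure_mono fun ω hω => ?_).trans (measure_biUnion_finset_le s _)
  by_contra hcon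
  simp only [Set.mem_iUnion, Set.mem_ofPred_eq, not_exists, not_le] at hcon hω
  have h1 : ‖∑ i ∈ s, f i k ω - ∑ i ∈ s, g i ω‖ ≤ ∑ _i ∈ s, ε / (s.card + 1) := by
    rw [← Finset.sum_sub_distrib]
    exact (norm_sum_le _ _).trans (Finset.sum_le_sum fun i hi => (hcon i hi).le)
  rw [Finset.sum_const, nsmul_eq_mul, mul_div_assoc'] at h1
  have h2 : (s.card : ℝ) * ε / (s.card + 1) < ε := by
    rw [div_lt_iff₀ hc]; nlinarith
  linarith

/-- The `t k` are deterministic: if `t k` exceeded `B + 1`, then `f k` and `g` would differ by at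
least 1 almost surely, that is on a set of measure 1, whereas such sets eventually have measure
below 1. -/
lemma eventually_le_of_tendstoInMeasure [IsProbabilityMeasure μ] {f : ℕ → Ω → ℝ} {g : Ω → ℝ}
    (h : TendstoInMeasure μ f atTop g) {B : ℝ} (hB : ∀ᵐ ω ∂μ, g ω ≤ B) {t : ℕ → ℝ}
    (ht : ∀ᶠ k in atTop, ∀ᵐ ω ∂μ, t k ≤ f k ω) : ∀ᶠ k in atTop, t k ≤ B + 1 := by
  have h1 := (tendstoInMeasure_iff_norm.1 h) 1 one_pos
  filter_upwards [h1.eventually (gt_mem_nhds one_pos), ht] with k hk htk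
  by_contra hcon
  have h2 : ∀ᵐ ω ∂μ, ω ∈ {ω | 1 ≤ ‖f k ω - g ω‖} := by
    filter_upwards [hB, htk] with ω h3 h4
    have : 1 ≤ f k ω - g ω := by linarith [not_le.1 hcon]
    exact this.trans (le_abs_self _)
  rw [measure_eq_measure_of_null_sdiff (Set.subset_univ _) (by
    rw [Set.sdiff_eq, Set.univ_inter]; exact h2), measure_univ] at hk
  exact lt_irrefl _ hk

/-- Convergence in probability to `0` of a sequence that is dominated, where a sequence bounded in
probability stays below any given level, by a sequence converging to `0` in mean. -/
lemma tendstoInMeasure_zero_of_dominated [IsProbabilityMeasure μ] {E : Type*}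
    [SeminormedAddCommGroup E] {Z : ℕ → Ω → E} {ρ : ℕ → Ω → ℝ} (hρ : BoundedInProbability μ ρ)
    (h : ∀ M : ℝ, 0 ≤ M → ∃ R : ℕ → Ω → ℝ, (∀ k ω, 0 ≤ R k ω) ∧
      (∀ᶠ k in atTop, Integrable (R k) μ) ∧
      Tendsto (fun k => ∫ ω, R k ω ∂μ) atTop (𝓝 0) ∧
      ∀ᶠ k in atTop, ∀ᵐ ω ∂μ, |ρ k ω| ≤ M → ‖Z k ω‖ ≤ R k ω) :
    TendstoInMeasure μ Z atTop (fun _ => 0) := by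
  rw [tendstoInMeasure_iff_norm]
  intro ε hε
  rw [ENNReal.tendsto_nhds_zero]
  intro η hη
  obtain ⟨M, hM⟩ := hρ (η / 2) (ENNReal.half_pos hη.ne')
  obtain ⟨R, hR0, hRi, hRt, hZ⟩ := h (max M 0) (le_max_right _ _)
  have hlim : Tendsto (fun k => ENNReal.ofReal ((∫ ω, R k ω ∂μ) / ε)) atTop (𝓝 0) := by
    simpa using ENNReal.tendsto_ofReal (hRt.div_const ε)
  filter_upwards [hM, hRi, hZ, (ENNReal.tendsto_nhds_zero.1 hlim) (η / 2)
    (ENNReal.half_pos hη.ne')] with k h1 h2 h3 h4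
  have hsub : μ {ω | ε ≤ ‖Z k ω - 0‖} ≤ μ ({ω | M < |ρ k ω|} ∪ {ω | ε ≤ R k ω}) := by
    refine measure_mono_ae ?_
    filter_upwards [h3] with ω hω hε'
    by_contra hcon
    have hcon' : ¬ (M < |ρ k ω| ∨ ε ≤ R k ω) := hcon
    rw [not_or, not_lt, not_le] at hcon'
    have h5 : ε ≤ ‖Z k ω - 0‖ := hε'
    rw [sub_zero] at h5
    linarith [hω (hcon'.1.trans (le_max_left _ _)), hcon'.2]
  have hmarkov : μ {ω | ε ≤ R k ω} ≤ ENNReal.ofReal ((∫ ω, R k ω ∂μ) / ε) := by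
    have h5 := mul_meas_ge_le_integral_of_nonneg (ae_of_all _ (hR0 k)) h2 ε
    rw [← ofReal_measureReal]
    refine ENNReal.ofReal_le_ofReal ?_
    rw [le_div_iff₀ hε]
    linarith
  calc _ ≤ _ := hsub
    _ ≤ η / 2 + η / 2 := (measure_union_le _ _).trans (add_le_add h1 (hmarkov.trans h4))
    _ = η := ENNReal.add_halves η

end InProbability

/-! ### Deterministic bounds on the design -/

section Design

variable {p : ℕ} {Ω : Type*} [MeasurableSpace Ω] {μ : Measure Ω} {S : GLMMSeq p Ω}

lemma boundedInProbability_penalty (h : CondC4 S μ) : BoundedInProbability μ (penalty S) :=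
  h.φhat_bounded.mul (.sum _ fun l _ => .sum _ fun l' _ => (h.inv_bounded l l').abs)

lemma nL_le {Ω : Type*} {S : GLMMSeq p Ω} {k i : ℕ} (hi : i < S.m k) : S.nL k ≤ S.n k i :=
  ciInf_le (OrderBot.bddBelow _) (⟨i, hi⟩ : Fin (S.m k))

lemma nL_le_nBar {Ω : Type*} {S : GLMMSeq p Ω} {k : ℕ} (hk : 0 < S.m k) :
    (S.nL k : ℝ) ≤ S.nBar k := by
  rw [GLMMSeq.nBar, le_div_iff₀ (by exact_mod_cast hk)]
  calc _ = ∑ _i : Fin (S.m k), (S.nL k : ℝ) := by simp [mul_comm]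
    _ ≤ _ := Finset.sum_le_sum fun i _ => by exact_mod_cast nL_le i.2

/-- The design matrices of all clusters have full rank, with a bound by the matrices `H_i`. -/
lemma eventually_invMinEig [IsProbabilityMeasure μ] (hmodel : IsGLMM S μ) (hgrowth : Growth S)
    (hC2 : CondC2 S μ) (hC4 : CondC4 S μ) {c₀ : ℝ} (hc₀ : 0 < c₀)
    (ha : ∀ η, 0 ≤ iteratedDeriv 2 S.a η) (ha' : ∀ η, iteratedDeriv 2 S.a η ≤ c₀⁻¹) :
    ∀ᶠ k in atTop, ∀ i < S.m k,
      (∀ v, S.n k i * ‖v‖ ^ 2 ≤ invMinEig S k i * gram S k i v) ∧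
      ∀ᵐ ω ∂μ, invMinEig S k i ≤ (c₀ * S.φ)⁻¹ * (S.H k i ω).trace := by
  have hφ := hmodel.dispersion_pos
  filter_upwards [hC2.isUnit_info, hgrowth.nL_tendsto.eventually_gt_atTop 0] with k hk hn i hi
  have hni : 0 < S.n k i := hn.trans_le (nL_le hi)
  have hae : ∀ᵐ ω ∂μ, 0 ≤ (c₀ * S.φ)⁻¹ * (S.H k i ω).trace ∧
      ∀ v, S.n k i * ‖v‖ ^ 2 ≤ (c₀ * S.φ)⁻¹ * (S.H k i ω).trace * gram S k i v := by
    filter_upwards [hk i hi, hC4.φhat_pos k] with ω h1 h2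
    exact ⟨mul_nonneg (by positivity) (posSemidef_H h2 hφ ha).trace_nonneg,
      norm_sq_le_trace_H_mul_gram hc₀ ha ha' hni h2 hφ h1⟩
  refine ⟨?_, ?_⟩
  · obtain ⟨ω, _, hω⟩ := hae.exists
    exact le_invMinEig_mul_gram hω
  · filter_upwards [hae] with ω hω
    exact invMinEig_le hω.1 hω.2

lemma exists_eventually_invMinEig_le [IsProbabilityMeasure μ] (hmodel : IsGLMM S μ)
    (hgrowth : Growth S) (hC2 : CondC2 S μ) (hC4 : CondC4 S μ) {c₀ : ℝ} (hc₀ : 0 < c₀)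
    (ha : ∀ η, 0 ≤ iteratedDeriv 2 S.a η) (ha' : ∀ η, iteratedDeriv 2 S.a η ≤ c₀⁻¹) (i : ℕ) :
    ∃ C : ℝ, ∀ᶠ k in atTop, invMinEig S k i ≤ C := by
  have hφ := hmodel.dispersion_pos
  obtain ⟨Kc, K, c₁, hc₁, hlim, -, hKc, -⟩ := hC2.limits
  have h1 := tendstoInMeasure_sum Finset.univ fun l _ => hlim i l l
  have h2 := eventually_le_of_tendstoInMeasure h1 (B := p * c₁⁻¹)
    (t := fun k => c₀ * S.φ * invMinEig S k i) (by
      filter_upwards [hKc i] with ω hω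
      exact trace_le_of_spectrum_subset hω.1 hω.2) (by
      filter_upwards [eventually_invMinEig hmodel hgrowth hC2 hC4 hc₀ ha ha',
        hgrowth.m_tendsto.eventually_gt_atTop i] with k hk hik
      filter_upwards [(hk i hik).2] with ω hω
      rwa [le_inv_mul_iff₀ (by positivity)] at hω)
  refine ⟨(p * c₁⁻¹ + 1) / (c₀ * S.φ), ?_⟩
  filter_upwards [h2] with k hk
  rw [le_div_iff₀ (by positivity)]
  linarith

/-- The convergence of each single `H_i` is not uniform in `i`; control of the mean over a growing
number of clusters comes from the limit of the averaged `H_i`. -/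
lemma exists_eventually_mean_invMinEig_le [IsProbabilityMeasure μ] (hmodel : IsGLMM S μ)
    (hgrowth : Growth S) (hC2 : CondC2 S μ) (hC4 : CondC4 S μ) {c₀ : ℝ} (hc₀ : 0 < c₀)
    (ha : ∀ η, 0 ≤ iteratedDeriv 2 S.a η) (ha' : ∀ η, iteratedDeriv 2 S.a η ≤ c₀⁻¹) :
    ∃ C : ℝ, ∀ᶠ k in atTop, (S.m k : ℝ)⁻¹ * ∑ i : Fin (S.m k), invMinEig S k i ≤ C := by
  have hφ := hmodel.dispersion_pos
  obtain ⟨Kc, K, c₁, hc₁, -, hlim, -, hK⟩ := hC2.limits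
  obtain ⟨C', hC'⟩ := hgrowth.balanced
  set C := max C' 1 with hCdef
  have hC0 : 0 < C := lt_max_of_lt_right one_pos
  have h1 := tendstoInMeasure_sum Finset.univ fun l _ => hlim l l
  have h2 := eventually_le_of_tendstoInMeasure h1 (B := p * c₁⁻¹)
    (t := fun k => (c₀ * S.φ * C⁻¹) * ((S.m k : ℝ)⁻¹ * ∑ i : Fin (S.m k), invMinEig S k i)) (by
      filter_upwards [hK] with ω hω
      exact trace_le_of_spectrum_subset hω.1 hω.2) (by
      filter_upwards [eventually_invMinEig hmodel hgrowth hC2 hC4 hc₀ ha ha', hC',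
        hgrowth.m_tendsto.eventually_gt_atTop 0, hgrowth.nL_tendsto.eventually_gt_atTop 0]
        with k hk hbal hm hn
      have hall : ∀ᵐ ω ∂μ, ∀ i : Fin (S.m k),
          invMinEig S k i ≤ (c₀ * S.φ)⁻¹ * (S.H k i ω).trace :=
        ae_all_iff.2 fun i => (hk i i.2).2
      filter_upwards [hall] with ω hω
      rw [← Finset.mul_sum, Finset.sum_comm, mul_left_comm]
      refine mul_le_mul_of_nonneg_left ?_ (by positivity)
      rw [Finset.mul_sum]
      refine Finset.sum_le_sum fun i _ => ?_
      rw [← Finset.mul_sum]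
      change _ ≤ _ * (S.H k i ω).trace
      have hni : (0 : ℝ) < S.n k i := by exact_mod_cast hn.trans_le (nL_le i.2)
      -- Balance, `n_i ≤ C n_L ≤ C n`, keeps the weights `n / n_i` of the average away from zero.
      have hratio : C⁻¹ ≤ S.nBar k * (S.n k i : ℝ)⁻¹ := by
        have hbar : 0 < S.nBar k := (Nat.cast_pos.2 hn).trans_le (nL_le_nBar hm)
        rw [← div_eq_mul_inv, inv_le_comm₀ hC0 (div_pos hbar hni), inv_div, div_le_iff₀ hbar]
        calc (S.n k i : ℝ) ≤ C' * S.nL k := hbal i i.2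
          _ ≤ C * S.nL k := by gcongr; exact le_max_left _ _
          _ ≤ C * S.nBar k := by gcongr; exact nL_le_nBar hm
      have h3 := hω i
      rw [le_inv_mul_iff₀ (by positivity)] at h3
      have h4 : 0 ≤ (S.H k i ω).trace :=
        (mul_nonneg (by positivity) (invMinEig_nonneg k i)).trans h3
      calc c₀ * S.φ * C⁻¹ * invMinEig S k i = C⁻¹ * (c₀ * S.φ * invMinEig S k i) := by ring
        _ ≤ C⁻¹ * (S.H k i ω).trace := by gcongr
        _ ≤ _ := by gcongr)
  refine ⟨(p * c₁⁻¹ + 1) / (c₀ * S.φ * C⁻¹), ?_⟩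
  filter_upwards [h2] with k hk
  rw [le_div_iff₀ (by positivity)]
  linarith

end Design

/-! ### Consistency of the predictor of a fixed cluster -/

section Consistency

variable {p : ℕ} {Ω : Type*} {S : GLMMSeq p Ω}

/-- Weighted mean of the norms of the normalised cluster scores. -/
def meanScore (S : GLMMSeq p Ω) (k : ℕ) (ω : Ω) : ℝ :=
  (S.m k : ℝ)⁻¹ * ∑ i : Fin (S.m k), invMinEig S k i * (‖score S k i ω‖ / S.n k i)

/-- Weighted mean of the norms of the random effects. -/
def meanEffect (S : GLMMSeq p Ω) (k : ℕ) (ω : Ω) : ℝ :=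
  (S.m k : ℝ)⁻¹ * ∑ i : Fin (S.m k), invMinEig S k i * ‖S.b i ω‖

/-- Bound for the prediction error of cluster `i`, where `c₀` bounds `a''` below, `C` bounds the
reciprocal eigenvalue of the cluster and `r` the penalty per observation. -/
def errorBound (S : GLMMSeq p Ω) (c₀ C : ℝ) (r : ℕ → ℝ) (i k : ℕ) (ω : Ω) : ℝ :=
  C / c₀ * (‖score S k i ω‖ / S.n k i) + r k * C * ‖S.b i ω‖ +
    4 * (‖(S.m k : ℝ)⁻¹ • ∑ i : Fin (S.m k), S.b i ω‖ + c₀⁻¹ * meanScore S k ω +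
      r k * meanEffect S k ω)

/-- The cluster bounds contain `‖βhat - β‖`, and `βhat - β` is in turn the mean random effect plus
the mean of the cluster errors. The loop closes because that norm returns with coefficient at most
`r K ≤ 1/2`; absorbing it costs the factor 2. -/
lemma norm_beta_error_le {c₀ M K r : ℝ} (hc₀ : 0 < c₀) {k : ℕ} {ω : Ω} (hm : 0 < S.m k)
    (hn : 0 < S.nL k) (hsum : ∑ i, S.bhat k ω i = 0) (hr : r = M / (c₀ * S.nL k))
    (hM : penalty S k ω ≤ M) (hM0 : 0 ≤ M)
    (hK : (S.m k : ℝ)⁻¹ * ∑ i : Fin (S.m k), invMinEig S k i ≤ K) (hrK : r * K ≤ 1 / 2)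
    (hδ : ∀ i : Fin (S.m k), ‖totalError S k ω i‖ ≤ invMinEig S k i *
      (‖score S k i ω‖ + penalty S k ω * (‖S.b i ω‖ + ‖S.βhat k ω - S.β‖)) / (c₀ * S.n k i)) :
    (∀ i : Fin (S.m k), ‖totalError S k ω i‖ ≤
      c₀⁻¹ * (invMinEig S k i * (‖score S k i ω‖ / S.n k i)) +
        r * (invMinEig S k i * ‖S.b i ω‖ + invMinEig S k i * ‖S.βhat k ω - S.β‖)) ∧
    ‖S.βhat k ω - S.β‖ ≤ 2 * (‖(S.m k : ℝ)⁻¹ • ∑ i : Fin (S.m k), S.b i ω‖ +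
      c₀⁻¹ * meanScore S k ω + r * meanEffect S k ω) := by
  set D := ‖S.βhat k ω - S.β‖ with hD
  have hD0 : 0 ≤ D := norm_nonneg _
  have hn' : (0 : ℝ) < S.nL k := by exact_mod_cast hn
  have hm' : (0 : ℝ) < S.m k := by exact_mod_cast hm
  have hr0 : 0 ≤ r := by rw [hr]; positivity
  have hδ' : ∀ i : Fin (S.m k), ‖totalError S k ω i‖ ≤
      c₀⁻¹ * (invMinEig S k i * (‖score S k i ω‖ / S.n k i)) +
        r * (invMinEig S k i * ‖S.b i ω‖ + invMinEig S k i * D) := by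
    intro i
    have hL := invMinEig_nonneg (S := S) k i
    have hle : (S.nL k : ℝ) ≤ S.n k i := by exact_mod_cast nL_le i.2
    have hni : (0 : ℝ) < S.n k i := hn'.trans_le hle
    have h1 : penalty S k ω / (c₀ * S.n k i) ≤ r := by
      rw [hr]; gcongr
    calc _ ≤ _ := hδ i
      _ = c₀⁻¹ * (invMinEig S k i * (‖score S k i ω‖ / S.n k i)) +
          penalty S k ω / (c₀ * S.n k i) *
            (invMinEig S k i * ‖S.b i ω‖ + invMinEig S k i * D) := by
        field_simp
      _ ≤ _ := by gcongr
  refine ⟨hδ', ?_⟩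
  -- Average the definition of the total error over the clusters; the predicted effects drop out
  -- since their sum is zero.
  have hΔ : S.βhat k ω - S.β = (S.m k : ℝ)⁻¹ • ∑ i : Fin (S.m k), S.b i ω +
      (S.m k : ℝ)⁻¹ • ∑ i, totalError S k ω i := by
    have h1 : ∑ i, totalError S k ω i =
        (S.m k : ℝ) • (S.βhat k ω - S.β) - ∑ i : Fin (S.m k), S.b i ω := by
      have h2 : ∀ i, totalError S k ω i = (S.βhat k ω - S.β) + S.bhat k ω i - S.b i ω :=
        fun i => by simp only [totalError]; abel
      simp only [h2, Finset.sum_sub_distrib, Finset.sum_add_distrib, hsum]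
      simp [Nat.cast_smul_eq_nsmul ℝ, smul_sub]
    rw [h1, smul_sub, smul_smul, inv_mul_cancel₀ hm'.ne', one_smul]
    abel
  have hmean : ‖(S.m k : ℝ)⁻¹ • ∑ i, totalError S k ω i‖ ≤
      c₀⁻¹ * meanScore S k ω + r * (meanEffect S k ω +
        (S.m k : ℝ)⁻¹ * (∑ i : Fin (S.m k), invMinEig S k i) * D) := by
    rw [norm_smul, Real.norm_of_nonneg (by positivity)]
    calc _ ≤ (S.m k : ℝ)⁻¹ * ∑ i : Fin (S.m k),
          (c₀⁻¹ * (invMinEig S k i * (‖score S k i ω‖ / S.n k i)) +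
            r * (invMinEig S k i * ‖S.b i ω‖ + invMinEig S k i * D)) := by
          gcongr
          exact (norm_sum_le _ _).trans (Finset.sum_le_sum fun i _ => hδ' i)
      _ = _ := by
          simp only [meanScore, meanEffect, Finset.sum_add_distrib, ← Finset.mul_sum,
            ← Finset.sum_mul]
          ring
  have h1 : D ≤ ‖(S.m k : ℝ)⁻¹ • ∑ i : Fin (S.m k), S.b i ω‖ +
      ‖(S.m k : ℝ)⁻¹ • ∑ i, totalError S k ω i‖ := by
    rw [hD, hΔ]; exact norm_add_le _ _
  have h2 : r * ((S.m k : ℝ)⁻¹ * (∑ i : Fin (S.m k), invMinEig S k i) * D) ≤ 1 / 2 * D := by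
    calc _ ≤ r * (K * D) := by gcongr
      _ = r * K * D := by ring
      _ ≤ _ := by gcongr
  linarith

lemma norm_bhat_sub_b_le {c₀ M K C : ℝ} {r : ℕ → ℝ} (hc₀ : 0 < c₀) {k : ℕ} {ω : Ω}
    (hn : 0 < S.nL k) (hsum : ∑ i, S.bhat k ω i = 0) (hr : r k = M / (c₀ * S.nL k))
    (hM : penalty S k ω ≤ M) (hM0 : 0 ≤ M)
    (hK : (S.m k : ℝ)⁻¹ * ∑ i : Fin (S.m k), invMinEig S k i ≤ K) (hrK : r k * K ≤ 1 / 2)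
    (hδ : ∀ i : Fin (S.m k), ‖totalError S k ω i‖ ≤ invMinEig S k i *
      (‖score S k i ω‖ + penalty S k ω * (‖S.b i ω‖ + ‖S.βhat k ω - S.β‖)) / (c₀ * S.n k i))
    (i : Fin (S.m k)) (hC : invMinEig S k i ≤ C) (hrC : r k * C ≤ 1) :
    ‖S.bhat k ω i - S.b i ω‖ ≤ errorBound S c₀ C r i k ω := by
  have hm : 0 < S.m k := i.pos
  obtain ⟨h1, h2⟩ := norm_beta_error_le hc₀ hm hn hsum hr hM hM0 hK hrK hδ
  have hr0 : 0 ≤ r k := by rw [hr]; positivity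
  have h3 : ‖S.bhat k ω i - S.b i ω‖ ≤ ‖totalError S k ω i‖ + ‖S.βhat k ω - S.β‖ := by
    rw [show S.bhat k ω i - S.b i ω = totalError S k ω i - (S.βhat k ω - S.β) by
      simp only [totalError]; abel]
    exact norm_sub_le _ _
  have h4 : ‖totalError S k ω i‖ ≤ c₀⁻¹ * (C * (‖score S k i ω‖ / S.n k i)) +
      r k * (C * ‖S.b i ω‖ + C * ‖S.βhat k ω - S.β‖) :=
    (h1 i).trans (by gcongr)
  -- The fixed-effect error thus enters at most twice, each time bounded with the factor 2, whence
  -- the 4 in `errorBound`.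
  have h5 : r k * C * ‖S.βhat k ω - S.β‖ ≤ ‖S.βhat k ω - S.β‖ :=
    mul_le_of_le_one_left (norm_nonneg _) hrC
  simp only [errorBound]
  have e : C / c₀ = c₀⁻¹ * C := by rw [div_eq_inv_mul]
  rw [e]
  linarith

lemma errorBound_nonneg {c₀ C : ℝ} {r : ℕ → ℝ} (hc₀ : 0 < c₀) (hC : 0 ≤ C) {k : ℕ}
    (hr : 0 ≤ r k) (i : ℕ) (ω : Ω) : 0 ≤ errorBound S c₀ C r i k ω := by
  have h1 : 0 ≤ meanScore S k ω := mul_nonneg (by positivity)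
    (Finset.sum_nonneg fun i _ => mul_nonneg (invMinEig_nonneg _ _) (by positivity))
  have h2 : 0 ≤ meanEffect S k ω := mul_nonneg (by positivity)
    (Finset.sum_nonneg fun i _ => mul_nonneg (invMinEig_nonneg _ _) (by positivity))
  unfold errorBound
  positivity

variable [MeasurableSpace Ω] {μ : Measure Ω}

lemma integrable_mean {m : ℕ} {w : Fin m → ℝ} {f : Fin m → Ω → ℝ} {Q K : ℝ}
    (hw : ∀ i, 0 ≤ w i) (hQ : 0 ≤ Q) (hK : (m : ℝ)⁻¹ * ∑ i, w i ≤ K)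
    (hf : ∀ i, Integrable (f i) μ) (hfQ : ∀ i, ∫ ω, f i ω ∂μ ≤ Q) :
    Integrable (fun ω => (m : ℝ)⁻¹ * ∑ i, w i * f i ω) μ ∧
      ∫ ω, (m : ℝ)⁻¹ * ∑ i, w i * f i ω ∂μ ≤ K * Q := by
  refine ⟨(integrable_finsetSum _ fun i _ => (hf i).const_mul _).const_mul _, ?_⟩
  rw [integral_const_mul, integral_finsetSum _ fun i _ => (hf i).const_mul _]
  simp only [integral_const_mul]
  calc _ ≤ (m : ℝ)⁻¹ * ∑ i, w i * Q := by
        gcongr with i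
        · exact hw i
        · exact hfQ i
    _ = (m : ℝ)⁻¹ * (∑ i, w i) * Q := by rw [← Finset.sum_mul]; ring
    _ ≤ _ := by gcongr

variable [IsProbabilityMeasure μ]

lemma integral_norm_score_div_le (h : IsGLMM S μ) (ha : ContDiff ℝ 2 S.a)
    {B : ℝ} (hB0 : 0 ≤ B) (hB : ∀ η, iteratedDeriv 2 S.a η ≤ B) {k i : ℕ} (hi : i < S.m k)
    (hn : 0 < S.nL k) {C : ℝ} (hC : ∀ j < S.n k i, ∀ l, |S.x k i j l| ≤ C) :
    Integrable (fun ω => ‖score S k i ω‖ / S.n k i) μ ∧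
      ∫ ω, ‖score S k i ω‖ / S.n k i ∂μ ≤ p * √(C ^ 2 * (S.φ * B)) / √(S.nL k) := by
  obtain ⟨h1, h2⟩ := integral_norm_score_le h ha hB0 hB hi hC
  have hn' : (0 : ℝ) < S.nL k := by exact_mod_cast hn
  have hle : (S.nL k : ℝ) ≤ S.n k i := by exact_mod_cast nL_le hi
  have hni : (0 : ℝ) < S.n k i := hn'.trans_le hle
  refine ⟨h1.div_const _, ?_⟩
  rw [integral_div]
  calc _ ≤ p * √(S.n k i * (C ^ 2 * (S.φ * B))) / S.n k i := by gcongr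
    -- The score grows like `√n_i`, so dividing by `n_i` leaves `1/√n_i`, which is uniform in `i`
    -- through `n_L`.
    _ = p * √(C ^ 2 * (S.φ * B)) / √(S.n k i) := by
      rw [Real.sqrt_mul hni.le]
      nth_rewrite 2 [← Real.mul_self_sqrt hni.le]
      have : 0 < √(S.n k i : ℝ) := Real.sqrt_pos.2 hni
      field_simp
    _ ≤ _ := by gcongr

lemma integral_errorBound_le (h : IsGLMM S μ) (ha : ContDiff ℝ 2 S.a)
    {B : ℝ} (hB0 : 0 ≤ B) (hB : ∀ η, iteratedDeriv 2 S.a η ≤ B) {k i : ℕ} (hi : i < S.m k)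
    (hn : 0 < S.nL k) {C₁ : ℝ} (hC₁ : ∀ i < S.m k, ∀ j < S.n k i, ∀ l, |S.x k i j l| ≤ C₁)
    {c₀ C K : ℝ} {r : ℕ → ℝ} (hc₀ : 0 < c₀) (hC : 0 ≤ C) (hr : 0 ≤ r k)
    (hK : (S.m k : ℝ)⁻¹ * ∑ i : Fin (S.m k), invMinEig S k i ≤ K) :
    Integrable (errorBound S c₀ C r i k) μ ∧ ∫ ω, errorBound S c₀ C r i k ω ∂μ ≤
      C / c₀ * (p * √(C₁ ^ 2 * (S.φ * B)) / √(S.nL k)) + r k * C * (p * √S.G.trace) +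
      4 * (p * √((S.m k : ℝ)⁻¹ * S.G.trace) +
        c₀⁻¹ * (K * (p * √(C₁ ^ 2 * (S.φ * B)) / √(S.nL k))) +
        r k * (K * (p * √S.G.trace))) := by
  have hm : 0 < S.m k := (Nat.zero_le i).trans_lt hi
  obtain ⟨s1, s2⟩ := integral_norm_score_div_le h ha hB0 hB hi hn (hC₁ i hi)
  obtain ⟨b1, b2⟩ := integral_norm_b_le h i
  obtain ⟨m1, m2⟩ := integral_norm_mean_b_le h hm
  obtain ⟨u1, u2⟩ := integrable_mean (μ := μ) (w := fun i : Fin (S.m k) => invMinEig S k i)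
    (f := fun i ω => ‖score S k i ω‖ / S.n k i) (fun i => invMinEig_nonneg k i)
    (by positivity) hK
    (fun i => (integral_norm_score_div_le h ha hB0 hB i.2 hn (hC₁ i i.2)).1)
    (fun i => (integral_norm_score_div_le h ha hB0 hB i.2 hn (hC₁ i i.2)).2)
  obtain ⟨v1, v2⟩ := integrable_mean (μ := μ) (w := fun i : Fin (S.m k) => invMinEig S k i)
    (f := fun i ω => ‖S.b i ω‖) (fun i => invMinEig_nonneg k i)
    (by positivity) hK (fun i => (integral_norm_b_le h i).1) (fun i => (integral_norm_b_le h i).2)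
  change Integrable (meanScore S k) μ at u1
  change ∫ ω, meanScore S k ω ∂μ ≤ _ at u2
  change Integrable (meanEffect S k) μ at v1
  change ∫ ω, meanEffect S k ω ∂μ ≤ _ at v2
  have i1 := s1.const_mul (C / c₀)
  have i2 := b1.const_mul (r k * C)
  have i3 := u1.const_mul c₀⁻¹
  have i4 := v1.const_mul (r k)
  have i5 := ((m1.fun_add i3).fun_add i4).const_mul 4
  refine ⟨(i1.fun_add i2).fun_add i5, ?_⟩
  simp only [errorBound]
  rw [integral_add (i1.fun_add i2) i5, integral_add i1 i2, integral_const_mul, integral_const_mul,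
    integral_const_mul, integral_add (m1.fun_add i3) i4, integral_add m1 i3, integral_const_mul,
    integral_const_mul]
  gcongr

/-- Consistency of the predictor of the random effect of a fixed cluster. -/
lemma tendstoInMeasure_bhatAt_sub_b (hmodel : IsGLMM S μ) (hPQL : IsPQLEstimator S μ)
    (hgrowth : Growth S) (hC1 : CondC1 S) (hC2 : CondC2 S μ) (hC4 : CondC4 S μ) (i : ℕ) :
    TendstoInMeasure μ (fun k ω => S.bhatAt i k ω - S.b i ω) atTop (fun _ => 0) := by
  obtain ⟨ha3, c₀, hc₀, hac⟩ := hC1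
  have ha : ContDiff ℝ 2 S.a := ha3.of_le (by norm_num)
  have ha0 : ∀ η, 0 ≤ iteratedDeriv 2 S.a η := fun η => hc₀.le.trans (hac η).1
  have ha1 : ∀ η, iteratedDeriv 2 S.a η ≤ c₀⁻¹ := fun η => (hac η).2.1
  obtain ⟨C₁, hC₁⟩ := hC2.bounded
  obtain ⟨C', hC'⟩ := exists_eventually_invMinEig_le hmodel hgrowth hC2 hC4 hc₀ ha0 ha1 i
  obtain ⟨K, hK⟩ := exists_eventually_mean_invMinEig_le hmodel hgrowth hC2 hC4 hc₀ ha0 ha1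
  set C := max C' 0 with hC
  have hC0 : 0 ≤ C := le_max_right _ _
  -- On the event that the penalty is at most `M` the bound is free of the working quantities, so
  -- their dependence on the responses plays no role in the expectations.
  refine tendstoInMeasure_zero_of_dominated (boundedInProbability_penalty hC4) fun M hM0 => ?_
  let r : ℕ → ℝ := fun k => M / (c₀ * S.nL k)
  have hr0 : ∀ k, 0 ≤ r k := fun k => by positivity
  have hnL : Tendsto (fun k => (S.nL k : ℝ)) atTop atTop :=
    tendsto_natCast_atTop_atTop.comp hgrowth.nL_tendsto
  have hm : Tendsto (fun k => (S.m k : ℝ)) atTop atTop :=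
    tendsto_natCast_atTop_atTop.comp hgrowth.m_tendsto
  have hr : Tendsto r atTop (𝓝 0) :=
    tendsto_const_nhds.div_atTop (hnL.const_mul_atTop hc₀)
  have hsq : Tendsto (fun k => √(S.nL k : ℝ)) atTop atTop := Real.tendsto_sqrt_atTop.comp hnL
  have hint : ∀ᶠ k in atTop, Integrable (errorBound S c₀ C r i k) μ ∧
      ∫ ω, errorBound S c₀ C r i k ω ∂μ ≤
      C / c₀ * (p * √(C₁ ^ 2 * (S.φ * c₀⁻¹)) / √(S.nL k)) + r k * C * (p * √S.G.trace) +
      4 * (p * √((S.m k : ℝ)⁻¹ * S.G.trace) +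
        c₀⁻¹ * (K * (p * √(C₁ ^ 2 * (S.φ * c₀⁻¹)) / √(S.nL k))) +
        r k * (K * (p * √S.G.trace))) := by
    filter_upwards [hK, hgrowth.m_tendsto.eventually_gt_atTop i,
      hgrowth.nL_tendsto.eventually_gt_atTop 0] with k h1 h2 h3
    exact integral_errorBound_le hmodel ha (by positivity) ha1 h2 h3
      (fun i hi j hj l => (hC₁ k i hi j hj l).le) hc₀ hC0 (hr0 k) h1
  refine ⟨errorBound S c₀ C r i, fun k ω => errorBound_nonneg hc₀ hC0 (hr0 k) i ω,
    hint.mono fun k hk => hk.1, ?_, ?_⟩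
  · refine tendsto_of_tendsto_of_tendsto_of_le_of_le' tendsto_const_nhds ?_
      (Eventually.of_forall fun k => integral_nonneg fun ω =>
        errorBound_nonneg hc₀ hC0 (hr0 k) i ω) (hint.mono fun k hk => hk.2)
    have t1 : Tendsto (fun k => p * √(C₁ ^ 2 * (S.φ * c₀⁻¹)) / √(S.nL k : ℝ)) atTop (𝓝 0) :=
      tendsto_const_nhds.div_atTop hsq
    have t2 : Tendsto (fun k => √((S.m k : ℝ)⁻¹ * S.G.trace)) atTop (𝓝 0) := by
      have : Tendsto (fun k => (S.m k : ℝ)⁻¹ * S.G.trace) atTop (𝓝 0) := by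
        simpa using (tendsto_inv_atTop_zero.comp hm).mul_const S.G.trace
      simpa using this.sqrt
    have t3 := (((t1.const_mul (C / c₀)).add ((hr.mul_const C).mul_const (p * √S.G.trace))).add
      ((((t2.const_mul (p : ℝ)).add ((t1.const_mul K).const_mul c₀⁻¹)).add
        (hr.mul_const (K * (p * √S.G.trace)))).const_mul 4))
    simpa using t3
  · have e1 : ∀ᶠ k in atTop, r k * K ≤ 1 / 2 := by
      have : Tendsto (fun k => r k * K) atTop (𝓝 0) := by simpa using hr.mul_const K
      exact (this.eventually (gt_mem_nhds (by norm_num : (0 : ℝ) < 1 / 2))).mono fun k hk => hk.le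
    have e2 : ∀ᶠ k in atTop, r k * C ≤ 1 := by
      have : Tendsto (fun k => r k * C) atTop (𝓝 0) := by simpa using hr.mul_const C
      exact (this.eventually (gt_mem_nhds one_pos)).mono fun k hk => hk.le
    filter_upwards [hK, hC', e1, e2, eventually_invMinEig hmodel hgrowth hC2 hC4 hc₀ ha0 ha1,
      hgrowth.m_tendsto.eventually_gt_atTop i, hgrowth.nL_tendsto.eventually_gt_atTop 0]
      with k hKk hCk hrK hrC hL hik hn
    filter_upwards [hPQL.isMax k, hC4.posDef k, hC4.φhat_pos k] with ω hmax hG hφ hpen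
    have hpen0 : 0 ≤ penalty S k ω := mul_nonneg hφ.le (entrySum_nonneg _)
    have hmain := norm_bhat_sub_b_le hc₀ hn (sum_eq_zero_of_isMax hG hmax) (r := r) rfl
      (le_of_abs_le hpen) hM0 hKk hrK (fun i' => norm_totalError_le hc₀
        (hn.trans_le (nL_le i'.2)) (by positivity) ((hL i' i'.2).1 _)
        (gram_totalError_le ha (fun η => (hac η).1) hG hφ hmax i'))
      ⟨i, hik⟩ (hCk.trans (le_max_left _ _)) hrC
    simpa [GLMMSeq.bhatAt, hik] using hmain

end Consistency

/-! ### Finite selections of clusters -/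

section Conclusion

variable {p : ℕ} {Ω : Type*} [MeasurableSpace Ω] {μ : Measure Ω} {S : GLMMSeq p Ω}

lemma tendstoInMeasure_zero_of_norm_le {E : Type*} [SeminormedAddCommGroup E] {Z : ℕ → Ω → E}
    {R : ℕ → Ω → ℝ} {C : ℝ} (hR : TendstoInMeasure μ R atTop fun _ => 0)
    (h : ∀ᶠ k in atTop, ∀ ω, ‖Z k ω‖ ≤ C * R k ω) :
    TendstoInMeasure μ Z atTop fun _ => 0 := by
  rw [tendstoInMeasure_iff_norm] at hR ⊢
  intro ε hε
  have hC : (0 : ℝ) < |C| + 1 := by positivity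
  refine tendsto_of_tendsto_of_tendsto_of_le_of_le' tendsto_const_nhds
    (hR (ε / (|C| + 1)) (by positivity)) (Eventually.of_forall fun _ => zero_le) ?_
  filter_upwards [h] with k hk
  refine measure_mono fun ω hω => ?_
  simp only [Set.mem_ofPred_eq, sub_zero] at hω ⊢
  rw [div_le_iff₀ hC]
  calc ε ≤ C * R k ω := hω.trans (hk ω)
    _ ≤ |C| * ‖R k ω‖ := by rw [Real.norm_eq_abs, ← abs_mul]; exact le_abs_self _
    _ ≤ ‖R k ω‖ * (|C| + 1) := by nlinarith [norm_nonneg (R k ω)]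

lemma tendstoInMeasure_sum_norm {ι E : Type*} [SeminormedAddCommGroup E] (s : Finset ι)
    {Z : ι → ℕ → Ω → E} (h : ∀ i ∈ s, TendstoInMeasure μ (Z i) atTop fun _ => 0) :
    TendstoInMeasure μ (fun k ω => ∑ i ∈ s, ‖Z i k ω‖) atTop fun _ => 0 := by
  have h1 : ∀ i ∈ s, TendstoInMeasure μ (fun k ω => ‖Z i k ω‖) atTop fun _ => 0 := by
    intro i hi
    have := h i hi
    rw [tendstoInMeasure_iff_norm] at this ⊢
    simpa using this
  simpa using tendstoInMeasure_sum s h1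

lemma measurable_bhatAt (hPQL : IsPQLEstimator S μ) (i k : ℕ) : Measurable (S.bhatAt i k) := by
  by_cases h : i < S.m k
  · have : S.bhatAt i k = fun ω => S.bhat k ω ⟨i, h⟩ := by ext ω; simp [GLMMSeq.bhatAt, h]
    rw [this]
    exact (measurable_pi_apply _).comp (hPQL.measurable_bhat k)
  · have : S.bhatAt i k = fun _ => 0 := by ext ω; simp [GLMMSeq.bhatAt, h]
    rw [this]
    exact measurable_const

/-- The rows of selection matrices involve the first `N` clusters only, with bounded entries. -/
lemma FiniteSelection.exists_bound {q : ℕ} {m : ℕ → ℕ}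
    {A : (k : ℕ) → Matrix (Fin q) (Fin (m k) × Fin p) ℝ} (hm : Tendsto m atTop atTop)
    (hA : FiniteSelection m A) : ∃ (N : ℕ) (C : ℝ), 0 ≤ C ∧ ∀ᶠ k in atTop,
      (∀ r (i : Fin (m k)), N ≤ (i : ℕ) → ∀ l, A k r (i, l) = 0) ∧
      ∀ r (i : Fin (m k)), (i : ℕ) < N → ∀ l, |A k r (i, l)| ≤ C := by
  choose m₀ hm₀ using hA.finite
  choose Lim hLim using hA.limit
  -- Sums stand in for maxima: `N` dominates every `m₀ r`, and `C` below dominates each `|Lim| + 1`,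
  -- which eventually bounds the corresponding entry.
  set N := ∑ r, m₀ r with hN
  have hle : ∀ r, m₀ r ≤ N := fun r =>
    Finset.single_le_sum (f := m₀) (fun _ _ => Nat.zero_le _) (Finset.mem_univ r)
  set C := ∑ r, ∑ i ∈ Finset.range N, ∑ l, (|Lim r i l| + 1) with hC
  have hbound : ∀ r, ∀ i < N, ∀ l, |Lim r i l| + 1 ≤ C := by
    intro r i hi l
    calc _ ≤ ∑ l, (|Lim r i l| + 1) :=
          Finset.single_le_sum (f := fun l => |Lim r i l| + 1) (fun _ _ => by positivity)
            (Finset.mem_univ l)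
      _ ≤ ∑ i ∈ Finset.range N, ∑ l, (|Lim r i l| + 1) :=
          Finset.single_le_sum (f := fun i => ∑ l, (|Lim r i l| + 1)) (fun _ _ => by positivity)
            (Finset.mem_range.2 hi)
      _ ≤ C := Finset.single_le_sum
          (f := fun r => ∑ i ∈ Finset.range N, ∑ l, (|Lim r i l| + 1)) (fun _ _ => by positivity)
            (Finset.mem_univ r)
  refine ⟨N, C, by positivity, ?_⟩
  have hev : ∀ᶠ k in atTop, ∀ r, ∀ i ∈ Finset.range N, ∀ l,
      |if h : i < m k then A k r (⟨i, h⟩, l) else 0| ≤ |Lim r i l| + 1 := by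
    rw [eventually_all]; intro r
    rw [eventually_all_finset]; intro i _
    rw [eventually_all]; intro l
    exact ((hLim r i l).abs.eventually (gt_mem_nhds (lt_add_one _))).mono fun k hk => hk.le
  filter_upwards [hev, hm.eventually_gt_atTop N] with k hk hmk
  refine ⟨fun r i hi l => hm₀ r k ((hle r).trans_lt hmk) i ((hle r).trans hi) l,
    fun r i hi l => ?_⟩
  have := hk r i (Finset.mem_range.2 hi) l
  rw [dif_pos i.2] at this
  exact this.trans (hbound r i hi l)

lemma norm_mulVec_selection_le {q : ℕ} {m N : ℕ} {A : Matrix (Fin q) (Fin m × Fin p) ℝ} {C : ℝ}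
    (hC : 0 ≤ C)
    (h0 : ∀ r (i : Fin m), N ≤ (i : ℕ) → ∀ l, A r (i, l) = 0)
    (hb : ∀ r (i : Fin m), (i : ℕ) < N → ∀ l, |A r (i, l)| ≤ C) (d : ℕ → Vec p) :
    ‖A *ᵥ fun il => d il.1 il.2‖ ≤ (C * p) * ∑ i ∈ Finset.range N, ‖d i‖ := by
  refine (pi_norm_le_iff_of_nonneg (by positivity)).2 fun r => ?_
  simp only [Matrix.mulVec, dotProduct, Fintype.sum_prod_type]
  refine (norm_sum_le _ _).trans ?_
  have hterm : ∀ i : Fin m, ‖∑ l, A r (i, l) * d i l‖ ≤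
      if (i : ℕ) < N then C * p * ‖d i‖ else 0 := by
    intro i
    split_ifs with hi
    · calc _ ≤ ∑ l, C * ‖d i‖ := by
            refine (norm_sum_le _ _).trans (Finset.sum_le_sum fun l _ => ?_)
            rw [norm_mul]
            exact mul_le_mul (hb r i hi l) (PiLp.norm_apply_le _ l) (norm_nonneg _) hC
        _ = _ := by simp; ring
    · simp [h0 r i (not_lt.1 hi)]
  refine (Finset.sum_le_sum fun i _ => hterm i).trans ?_
  rw [Fin.sum_univ_eq_sum_range (fun i => if i < N then C * p * ‖d i‖ else 0) m,
    ← Finset.sum_filter, Finset.mul_sum]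
  refine Finset.sum_le_sum_of_subset_of_nonneg (fun i hi => ?_) fun _ _ _ => by positivity
  simpa using (Finset.mem_filter.1 hi).2

end Conclusion

end PQL

end

theorem theorem3 {p q : ℕ} {Ω : Type*} [MeasurableSpace Ω] (μ : Measure Ω) [IsProbabilityMeasure μ]
    (S : PQL.GLMMSeq p Ω) (hmodel : PQL.IsGLMM S μ) (hPQL : PQL.IsPQLEstimator S μ)
    (hgrowth : PQL.Growth S)
    (hrate : Tendsto (fun k => (S.m k : ℝ) / (S.nL k : ℝ) ^ 2) atTop (𝓝 0))
    (hC1 : PQL.CondC1 S) (hC2 : PQL.CondC2 S μ) (hC3 : PQL.CondC3 S μ) (hC4 : PQL.CondC4 S μ)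
    (hC5 : PQL.CondC5 S μ)
    (A : (k : ℕ) → Matrix (Fin q) (Fin (S.m k) × Fin p) ℝ) (hA : PQL.FiniteSelection S.m A) :
    TendstoInMeasure μ
      (fun k ω => A k *ᵥ fun il => (S.bhat k ω il.1 - S.bTrue k ω il.1) il.2) atTop
      (fun _ => (0 : Fin q → ℝ)) ∧
    (∀ i : ℕ, TendstoInDistribution (S.bhatAt i) atTop (S.b i) (fun _ => μ) μ) ∧
    (∀ s : Finset ℕ, TendstoInDistribution (fun k ω (i : s) => S.bhatAt i k ω) atTop
      (fun ω (i : s) => S.b i ω) (fun _ => μ) μ) := by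
  have hcons := PQL.tendstoInMeasure_bhatAt_sub_b hmodel hPQL hgrowth hC1 hC2 hC4
  refine ⟨?_, fun i => ?_, fun s => ?_⟩
  · obtain ⟨N, C, hC, hev⟩ := hA.exists_bound hgrowth.m_tendsto
    refine PQL.tendstoInMeasure_zero_of_norm_le
      (PQL.tendstoInMeasure_sum_norm (Finset.range N) fun i _ => hcons i) (C := C * p) ?_
    filter_upwards [hev] with k hk ω
    have := PQL.norm_mulVec_selection_le hC hk.1 hk.2 fun i => S.bhatAt i k ω - S.b i ω
    simpa [PQL.GLMMSeq.bhatAt, PQL.GLMMSeq.bTrue] using this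
  -- The target `b_i` lives on the same space and does not vary with `k`, so convergence in
  -- probability implies convergence in distribution.
  · refine TendstoInMeasure.tendstoInDistribution ?_ fun k =>
      (PQL.measurable_bhatAt hPQL i k).aemeasurable
    have := hcons i
    rw [tendstoInMeasure_iff_norm] at this ⊢
    simpa using this
  · refine TendstoInMeasure.tendstoInDistribution ?_ fun k =>
      (measurable_pi_lambda _ fun i : s => PQL.measurable_bhatAt hPQL i k).aemeasurable
    -- Joint convergence: the sup norm over `s` is at most the sum of the norms of the coordinates.
    have h1 := PQL.tendstoInMeasure_zero_of_norm_le (μ := μ)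
      (Z := fun k ω (i : s) => S.bhatAt i k ω - S.b i ω)
      (PQL.tendstoInMeasure_sum_norm (Finset.univ : Finset s) fun i _ => hcons i) (C := 1) (by
        refine Eventually.of_forall fun k ω => ?_
        rw [one_mul]
        exact (pi_norm_le_iff_of_nonneg (Finset.sum_nonneg fun _ _ => norm_nonneg _)).2 fun i =>
          Finset.single_le_sum (f := fun i : s => ‖S.bhatAt i k ω - S.b i ω‖)
            (fun _ _ => norm_nonneg _) (Finset.mem_univ i))
    rw [tendstoInMeasure_iff_norm] at h1 ⊢
    simpa [Pi.sub_def] using h1
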